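/- For $\eta\in[0,1]$ let $\mathcal A(\rho)=K_0\rho K_0^\dagger+K_1\rho K_1^\dagger$ be the qubit amplitude damping channel of transmissivity $\eta$, where $K_0=|1\rangle\langle 1|+\sqrt{\eta}\,|0\rangle\langle 0|$ and $K_1=\sqrt{1-\eta}\,|1\rangle\langle 0|$. For a finite ensemble $\{p_X(x),|\phi^x\rangle_{AA'}\}$ of pure states on $AA'$, where $A'$ is a qubit and $A$ is a reference system of any finite dimension, put $$\rho_{XAB}=\sum_x p_X(x)\,|x\rangle\langle x|_X\otimes(\mathrm{id}_A\otimes\mathcal A_{A'\to B})\bigl(|\phi^x\rangle\langle\phi^x|_{AA'}\bigr).$$ With the von Neumann entropies $H$ (logarithms to base $2$) of this state and of its marginals, put $I(AX;B)=H(AX)+H(B)-H(ABX)$, $I(A\rangle BX)=H(BX)-H(ABX)$ and $I(X;B)=H(X)+H(B)-H(BX)$. The single-letter triple (classical, quantum, entanglement) trade-off region of $\mathcal A$ is the union, over all such ensembles, of the polyhedra of all $(C,Q,E)\in\mathbb R^3$ with $$C+2Q\le I(AX;B),\qquad Q+E\le I(A\rangle BX),\qquad C+Q+E\le I(X;B)+I(A\rangle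 BX).$$ Let $h_2(y)=-y\log_2 y-(1-y)\log_2(1-y)$ for $y\in[0,1]$ (with $0\log_2 0=0$) and $$g(q,z,\nu)=h_2\!\left(\frac{1+\sqrt{(1-2zq)^2+4z\nu^2q(1-q)}}{2}\right).$$ Theorem. For every $\eta\in[0,1]$, the single-letter triple trade-off region of $\mathcal A$ equals the union, over all $p_0,q_0,q_1,\nu_0,\nu_1\in[0,1]$, with $p_1=1-p_0$ and $p=p_0q_0+p_1q_1$, of the polyhedra of all $(C,Q,E)\in\mathbb R^3$ with $$C+2Q\le h_2(\eta p)+\sum_{x\in\{0,1\}}p_x\,[g(q_x,1,\nu_x)-g(q_x,1-\eta,\nu_x)],$$ $$Q+E\le\sum_{x\in\{0,1\}}p_x\,[g(q_x,\eta,\nu_x)-g(q_x,1-\eta,\nu_x)],$$ $$C+Q+E\le h_2(\eta p)-\sum_{x\in\{0,1\}}p_x\,g(q_x,1-\eta,\nu_x).$$ -/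

import Mathlib

open scoped Matrix Kronecker

noncomputable section

namespace TripleTradeoff

/-- The von Neumann entropy `H(ρ) = -Tr (ρ log₂ ρ)` of a Hermitian matrix, i.e. the sum of
`-t log₂ t` over its eigenvalues `t` with multiplicity (and `0 log₂ 0 = 0`).
It is only used for density matrices; the value at a non-Hermitian matrix is set to `0`. -/
def vnEntropy {n : Type*} [Fintype n] [DecidableEq n] (ρ : Matrix n n ℂ) : ℝ :=
  open Classical in
  if h : ρ.IsHermitian then ∑ i, -(h.eigenvalues i * Real.logb 2 (h.eigenvalues i)) else 0

/-- The map `id_A ⊗ 𝒩` for the map `𝒩(ρ) = ∑ j, K j * ρ * (K j)ᴴ` with Kraus operators `K`. -/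
def applyKraus {κ A A' B : Type*} [Fintype κ] [Fintype A] [DecidableEq A] [Fintype A']
    (K : κ → Matrix B A' ℂ) (ρ : Matrix (A × A') (A × A') ℂ) : Matrix (A × B) (A × B) ℂ :=
  ∑ j, ((1 : Matrix A A ℂ) ⊗ₖ K j) * ρ * ((1 : Matrix A A ℂ) ⊗ₖ K j)ᴴ

/-- The classical-quantum state
`ρ_XAB = ∑ x, p x |x⟩⟨x| ⊗ (id_A ⊗ 𝒩)(|φ x⟩⟨φ x|)` of an ensemble of pure states `φ x` on `AA'`. -/
def cqState {κ X A A' B : Type*} [Fintype κ] [Fintype X] [DecidableEq X] [Fintype A]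
    [DecidableEq A] [Fintype A'] (K : κ → Matrix B A' ℂ) (p : X → ℝ) (φ : X → A × A' → ℂ) :
    Matrix (X × A × B) (X × A × B) ℂ :=
  ∑ x, ((p x : ℝ) : ℂ) •
    (Matrix.single x x (1 : ℂ) ⊗ₖ applyKraus K (Matrix.vecMulVec (φ x) (star (φ x))))

section Marginals

variable {X A B : Type*} [Fintype X] [Fintype A] [Fintype B]

/-- The reduced state on `XA` (trace over `B`). -/
def margXA (ρ : Matrix (X × A × B) (X × A × B) ℂ) : Matrix (X × A) (X × A) ℂ :=
  Matrix.of fun i j => ∑ b, ρ (i.1, i.2, b) (j.1, j.2, b)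

/-- The reduced state on `XB` (trace over `A`). -/
def margXB (ρ : Matrix (X × A × B) (X × A × B) ℂ) : Matrix (X × B) (X × B) ℂ :=
  Matrix.of fun i j => ∑ a, ρ (i.1, a, i.2) (j.1, a, j.2)

/-- The reduced state on `X` (trace over `AB`). -/
def margX (ρ : Matrix (X × A × B) (X × A × B) ℂ) : Matrix X X ℂ :=
  Matrix.of fun i j => ∑ a, ∑ b, ρ (i, a, b) (j, a, b)

/-- The reduced state on `B` (trace over `XA`). -/
def margB (ρ : Matrix (X × A × B) (X × A × B) ℂ) : Matrix B B ℂ :=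
  Matrix.of fun i j => ∑ x, ∑ a, ρ (x, a, i) (x, a, j)

variable [DecidableEq X] [DecidableEq A] [DecidableEq B]

/-- The quantum mutual information `I(AX;B) = H(AX) + H(B) - H(ABX)`. -/
def mutualInfo (ρ : Matrix (X × A × B) (X × A × B) ℂ) : ℝ :=
  vnEntropy (margXA ρ) + vnEntropy (margB ρ) - vnEntropy ρ

/-- The coherent information `I(A⟩BX) = H(BX) - H(ABX)`. -/
def coherentInfo (ρ : Matrix (X × A × B) (X × A × B) ℂ) : ℝ :=
  vnEntropy (margXB ρ) - vnEntropy ρ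

/-- The Holevo information `I(X;B) = H(X) + H(B) - H(BX)`. -/
def holevoInfo (ρ : Matrix (X × A × B) (X × A × B) ℂ) : ℝ :=
  vnEntropy (margX ρ) + vnEntropy (margB ρ) - vnEntropy (margXB ρ)

end Marginals

/-- The polyhedron of all rate triples `(C, Q, E)` with
`C + 2Q ≤ a`, `Q + E ≤ b` and `C + Q + E ≤ c`. -/
def ratePolyhedron (a b c : ℝ) : Set (ℝ × ℝ × ℝ) :=
  {r | r.1 + 2 * r.2.1 ≤ a ∧ r.2.1 + r.2.2 ≤ b ∧ r.1 + r.2.1 + r.2.2 ≤ c}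

/-- The single-letter triple trade-off region of the channel with Kraus operators `K`: the union
of the polyhedra `C + 2Q ≤ I(AX;B)`, `Q + E ≤ I(A⟩BX)`, `C + Q + E ≤ I(X;B) + I(A⟩BX)` over all
ensembles `{p x, |φ x⟩}` of finitely many pure states on `AA'`, with `A` of any finite dimension. -/
def tripleRegion {κ A' B : Type*} [Fintype κ] [Fintype A'] [Fintype B] [DecidableEq B]
    (K : κ → Matrix B A' ℂ) : Set (ℝ × ℝ × ℝ) :=
  {r | ∃ (n d : ℕ) (p : Fin n → ℝ) (φ : Fin n → Fin d × A' → ℂ),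
    (∀ x, 0 ≤ p x) ∧ ∑ x, p x = 1 ∧ (∀ x, ∑ i, ‖φ x i‖ ^ 2 = 1) ∧
    r ∈ ratePolyhedron (mutualInfo (cqState K p φ)) (coherentInfo (cqState K p φ))
      (holevoInfo (cqState K p φ) + coherentInfo (cqState K p φ))}

/-- The Kraus operators `K₀ = |1⟩⟨1| + √η |0⟩⟨0|` and `K₁ = √(1-η) |1⟩⟨0|` of the qubit amplitude
damping channel of transmissivity `η`. The index `0 : Fin 2` stands for `|0⟩`, which decays to
`|1⟩`. -/
def ampDampKraus (η : ℝ) : Fin 2 → Matrix (Fin 2) (Fin 2) ℂ :=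
  ![Matrix.single 1 1 (1 : ℂ) + Matrix.single 0 0 ((√η : ℝ) : ℂ),
    Matrix.single 1 0 ((√(1 - η) : ℝ) : ℂ)]

/-- The binary entropy `h₂(y) = -y log₂ y - (1-y) log₂ (1-y)`. -/
def h2 (y : ℝ) : ℝ := -y * Real.logb 2 y - (1 - y) * Real.logb 2 (1 - y)

/-- The function `g(q, z, ν)`. -/
def g (q z ν : ℝ) : ℝ :=
  h2 ((1 + √((1 - 2 * z * q) ^ 2 + 4 * z * ν ^ 2 * q * (1 - q))) / 2)

end TripleTradeoff

end

/-!
Write `N_z` for amplitude damping of transmissivity `z`, so that the complementary channel of `N_η`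
is `N_(1 - η)` up to relabelling the basis. Given `x`, the states of `A`, `B` and `AB` have the
entropies of the outputs of `N_1`, `N_η` and `N_(1 - η)` on the reduced state on `A'`, and the
entropy of a qubit output depends only on the population `q` of `|0⟩` and the determinant `Y` of
the input.

Replacing each state by an equal mixture of the states with coherences `ν` and `-ν` keeps these
conditional entropies and makes the mean input diagonal, which maximises `H(B)` for a given mean
population.

It remains to replace an ensemble by a single state with the same mean population for which all
three bounds are at least as large. If a function `V` of `(q, Y)` is concave along all curves that
are affine in `q` and in the value of `U`, then by Jensen's inequality the state with the mean
population and the mean value of `U` has at least the mean value of `V`. For `η ≥ 1/2` take for `U`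
the entropy of `N_(1 - η)` and for `V` that of `N_1` or `N_η`; for `η < 1/2` take for `U` the
difference of the entropies of `N_(1 - η)` and `N_η`, and for `V` that of `N_1` and `N_(1 - η)`. The
concavity is an inequality between the curvatures of the entropy at two or three determinants,
which becomes a family of hyperbolic inequalities when a determinant is written as
`1 / (4 * cosh a ^ 2)`.
-/

noncomputable section

namespace TripleTradeoff

open Real Set

/-! ### Hyperbolic inequalities -/

section Hyperbolic

variable {F F' : ℝ → ℝ} {s : Set ℝ} {a : ℝ}

theorem monotoneOn_of_hasDerivAt_nonneg (hs : Convex ℝ s) (hF : ∀ x ∈ s, HasDerivAt F (F' x) x)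
    (hF' : ∀ x ∈ s, 0 ≤ F' x) : MonotoneOn F s :=
  monotoneOn_of_hasDerivWithinAt_nonneg hs (fun x hx => (hF x hx).continuousAt.continuousWithinAt)
    (fun x hx => (hF x (interior_subset hx)).hasDerivWithinAt)
    fun x hx => hF' x (interior_subset hx)

theorem antitoneOn_of_hasDerivAt_nonpos (hs : Convex ℝ s) (hF : ∀ x ∈ s, HasDerivAt F (F' x) x)
    (hF' : ∀ x ∈ s, F' x ≤ 0) : AntitoneOn F s :=
  antitoneOn_of_hasDerivWithinAt_nonpos hs (fun x hx => (hF x hx).continuousAt.continuousWithinAt)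
    (fun x hx => (hF x (interior_subset hx)).hasDerivWithinAt)
    fun x hx => hF' x (interior_subset hx)

theorem convexOn_of_hasDerivAt_monotoneOn (hs : Convex ℝ s) (hopen : IsOpen s)
    (hF : ∀ x ∈ s, HasDerivAt F (F' x) x) (hF' : MonotoneOn F' s) : ConvexOn ℝ s F :=
  MonotoneOn.convexOn_of_deriv hs (fun x hx => (hF x hx).continuousAt.continuousWithinAt)
    (fun x hx => (hF x (interior_subset hx)).differentiableAt.differentiableWithinAt) <| by
      rw [hopen.interior_eq]
      exact hF'.congr fun x hx => (hF x hx).deriv.symm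

theorem concaveOn_of_hasDerivAt_antitoneOn (hs : Convex ℝ s) (hopen : IsOpen s)
    (hF : ∀ x ∈ s, HasDerivAt F (F' x) x) (hF' : AntitoneOn F' s) : ConcaveOn ℝ s F :=
  neg_convexOn_iff.1
    (convexOn_of_hasDerivAt_monotoneOn hs hopen (fun x hx => (hF x hx).neg) hF'.neg)

theorem nonneg_of_hasDerivAt_nonneg (h0 : 0 ≤ F 0) (hF : ∀ x, HasDerivAt F (F' x) x)
    (hF' : ∀ x, 0 ≤ x → 0 ≤ F' x) (ha : 0 ≤ a) : 0 ≤ F a :=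
  h0.trans (monotoneOn_of_hasDerivAt_nonneg (convex_Ici 0) (fun x _ => hF x) hF'
    self_mem_Ici (mem_Ici.2 ha) ha)

theorem hasDerivAt_mul_cosh_sub_sinh (a : ℝ) :
    HasDerivAt (fun a => a * cosh a - sinh a) (a * sinh a) a := by
  refine (((hasDerivAt_id' a).fun_mul (hasDerivAt_cosh a)).fun_sub
    (hasDerivAt_sinh a)).congr_deriv ?_
  ring

theorem hasDerivAt_sinh_mul_cosh_sub (a : ℝ) :
    HasDerivAt (fun a => sinh a * cosh a - a) (2 * sinh a ^ 2) a := by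
  refine (((hasDerivAt_sinh a).fun_mul (hasDerivAt_cosh a)).fun_sub
    (hasDerivAt_id' a)).congr_deriv ?_
  linear_combination cosh_sq a

theorem sinh_lt_mul_cosh (ha : 0 < a) : sinh a < a * cosh a := by
  have hmono : StrictMonoOn (fun a => a * cosh a - sinh a) (Ici 0) :=
    strictMonoOn_of_hasDerivWithinAt_pos (convex_Ici 0) (by fun_prop)
      (fun x _ => (hasDerivAt_mul_cosh_sub_sinh x).hasDerivWithinAt) fun x hx => by
        have hx : 0 < x := by simpa using hx
        exact mul_pos hx (sinh_pos_iff.2 hx)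
  simpa using hmono self_mem_Ici (mem_Ici.2 ha.le) ha

theorem sinh_le_mul_cosh (ha : 0 ≤ a) : sinh a ≤ a * cosh a := by
  rcases ha.eq_or_lt with rfl | ha
  · simp
  · exact (sinh_lt_mul_cosh ha).le

theorem le_sinh_mul_cosh (ha : 0 ≤ a) : a ≤ sinh a * cosh a :=
  (self_le_sinh_iff.2 ha).trans (le_mul_of_one_le_right (sinh_nonneg_iff.2 ha) (one_le_cosh a))

theorem lt_sinh_mul_cosh (ha : 0 < a) : a < sinh a * cosh a :=
  (self_lt_sinh_iff.2 ha).trans_le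
    (le_mul_of_one_le_right (sinh_pos_iff.2 ha).le (one_le_cosh a))

theorem three_mul_mul_cosh_sub_sinh_le (ha : 0 ≤ a) :
    3 * (a * cosh a - sinh a) ≤ a ^ 2 * sinh a := by
  refine sub_nonneg.1 <| nonneg_of_hasDerivAt_nonneg
    (F := fun a => a ^ 2 * sinh a - 3 * (a * cosh a - sinh a))
    (F' := fun a => a * (a * cosh a - sinh a)) (by simp) (fun a => ?_)
    (fun a ha => mul_nonneg ha (sub_nonneg.2 (sinh_le_mul_cosh ha))) ha
  refine ((((hasDerivAt_id' a).fun_pow 2).fun_mul (hasDerivAt_sinh a)).fun_sub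
    ((hasDerivAt_mul_cosh_sub_sinh a).const_mul 3)).congr_deriv ?_
  ring

theorem three_mul_sinh_mul_cosh_le (ha : 0 ≤ a) :
    3 * (sinh a * cosh a - a) ≤ 2 * a * sinh a ^ 2 := by
  refine sub_nonneg.1 <| nonneg_of_hasDerivAt_nonneg
    (F := fun a => 2 * a * sinh a ^ 2 - 3 * (sinh a * cosh a - a))
    (F' := fun a => 4 * sinh a * (a * cosh a - sinh a)) (by simp) (fun a => ?_)
    (fun a ha => ?_) ha
  · refine ((((hasDerivAt_id' a).const_mul 2).fun_mul ((hasDerivAt_sinh a).fun_pow 2)).fun_sub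
      ((hasDerivAt_sinh_mul_cosh_sub a).const_mul 3)).congr_deriv ?_
    ring
  · have := sinh_nonneg_iff.2 ha
    have := sub_nonneg.2 (sinh_le_mul_cosh ha)
    positivity

theorem two_mul_sinh_sq_le (ha : 0 ≤ a) :
    2 * sinh a ^ 2 ≤ a ^ 2 + a * sinh a * cosh a := by
  refine sub_nonneg.1 <| nonneg_of_hasDerivAt_nonneg
    (F := fun a => a ^ 2 + a * sinh a * cosh a - 2 * sinh a ^ 2)
    (F' := fun a => 2 * a * sinh a ^ 2 - 3 * (sinh a * cosh a - a)) (by simp) (fun a => ?_)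
    (fun a ha => sub_nonneg.2 (three_mul_sinh_mul_cosh_le ha)) ha
  refine ((((hasDerivAt_id' a).fun_pow 2).fun_add
    (((hasDerivAt_id' a).fun_mul (hasDerivAt_sinh a)).fun_mul (hasDerivAt_cosh a))).fun_sub
    (((hasDerivAt_sinh a).fun_pow 2).const_mul 2)).congr_deriv ?_
  linear_combination a * cosh_sq a

theorem three_mul_cosh_add_two_sq_mul_sinh_le (ha : 0 ≤ a) :
    3 * a * cosh a + 2 * a ^ 2 * sinh a ≤ 3 * sinh a * cosh a ^ 2 := by
  refine sub_nonneg.1 <| nonneg_of_hasDerivAt_nonneg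
    (F := fun a => 3 * sinh a * cosh a ^ 2 - (3 * a * cosh a + 2 * a ^ 2 * sinh a))
    (F' := fun a => 7 * sinh a * (sinh a * cosh a - a) + 2 * cosh a * (sinh a ^ 2 - a ^ 2))
    (by simp) (fun a => ?_) (fun a ha => ?_) ha
  · refine ((((hasDerivAt_sinh a).const_mul 3).fun_mul ((hasDerivAt_cosh a).fun_pow 2)).fun_sub
      ((((hasDerivAt_id' a).const_mul 3).fun_mul (hasDerivAt_cosh a)).fun_add
      ((((hasDerivAt_id' a).fun_pow 2).const_mul 2).fun_mul (hasDerivAt_sinh a)))).congr_deriv ?_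
    linear_combination 3 * cosh a * cosh_sq a
  · have := sinh_nonneg_iff.2 ha
    have := cosh_pos a
    have := sub_nonneg.2 (le_sinh_mul_cosh ha)
    have : 0 ≤ sinh a ^ 2 - a ^ 2 := sub_nonneg.2 (by gcongr; exact self_le_sinh_iff.2 ha)
    positivity

theorem two_mul_sq_mul_cosh_le (ha : 0 ≤ a) :
    2 * a ^ 2 * cosh a ≤ sinh a ^ 2 * cosh a + a * sinh a := by
  refine sub_nonneg.1 <| nonneg_of_hasDerivAt_nonneg
    (F := fun a => sinh a ^ 2 * cosh a + a * sinh a - 2 * a ^ 2 * cosh a)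
    (F' := fun a => 3 * sinh a * cosh a ^ 2 - (3 * a * cosh a + 2 * a ^ 2 * sinh a))
    (by simp) (fun a => ?_)
    (fun a ha => sub_nonneg.2 (three_mul_cosh_add_two_sq_mul_sinh_le ha)) ha
  refine (((((hasDerivAt_sinh a).fun_pow 2).fun_mul (hasDerivAt_cosh a)).fun_add
    ((hasDerivAt_id' a).fun_mul (hasDerivAt_sinh a))).fun_sub
    ((((hasDerivAt_id' a).fun_pow 2).const_mul 2).fun_mul (hasDerivAt_cosh a))).congr_deriv ?_
  linear_combination -sinh a * cosh_sq a

theorem factorial_two_mul_succ (n : ℕ) :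
    ((2 * (n + 1)).factorial : ℝ) = (2 * (n + 1)) * ((2 * n + 1) * (2 * n).factorial) := by
  rw [show 2 * (n + 1) = 2 * n + 1 + 1 by ring, Nat.factorial_succ, Nat.factorial_succ]
  push_cast
  ring

theorem hasSum_cosh_mul (m b : ℝ) :
    HasSum (fun n : ℕ => m ^ (2 * n) * (b ^ (2 * n) / (2 * n).factorial)) (cosh (m * b)) := by
  simpa only [mul_pow, mul_div_assoc] using hasSum_cosh (m * b)

theorem hasSum_mul_sinh_mul {m : ℝ} (hm : m ≠ 0) (b : ℝ) :
    HasSum (fun n : ℕ => 2 * n * m ^ (2 * n) / m * (b ^ (2 * n) / (2 * n).factorial))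
      (b * sinh (m * b)) := by
  rw [← hasSum_nat_add_iff' 1]
  convert! (hasSum_sinh (m * b)).mul_left b using 1
  · ext n
    rw [factorial_two_mul_succ, Nat.factorial_succ]
    push_cast
    field_simp
    ring
  · simp

theorem hasSum_sq_mul_cosh_mul {m : ℝ} (hm : m ≠ 0) (b : ℝ) :
    HasSum (fun n : ℕ => 2 * n * (2 * n - 1) * m ^ (2 * n) / m ^ 2 *
      (b ^ (2 * n) / (2 * n).factorial)) (b ^ 2 * cosh (m * b)) := by
  rw [← hasSum_nat_add_iff' 1]
  convert! (hasSum_cosh (m * b)).mul_left (b ^ 2) using 1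
  · ext n
    rw [factorial_two_mul_succ]
    push_cast
    field_simp
    ring
  · simp

theorem hasSum_cube_mul_sinh_mul {m : ℝ} (hm : m ≠ 0) (b : ℝ) :
    HasSum (fun n : ℕ => 2 * n * (2 * n - 1) * (2 * n - 2) * m ^ (2 * n) / m ^ 3 *
      (b ^ (2 * n) / (2 * n).factorial)) (b ^ 3 * sinh (m * b)) := by
  rw [← hasSum_nat_add_iff' 1]
  convert! (hasSum_mul_sinh_mul hm b).mul_left (b ^ 2) using 1
  · ext n
    rw [factorial_two_mul_succ]
    push_cast
    field_simp
    ring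
  · simp
    ring

theorem nine_pow_mul_le_twentyfive_pow {n : ℕ} (hn : 5 ≤ n) :
    (9 : ℝ) ^ n * ((32 * n ^ 2 - 96 * n) / 3 + 16) ≤ 25 ^ n := by
  induction n, hn using Nat.le_induction with
  | base => norm_num
  | succ n hn ih =>
    have hn' : (5 : ℝ) ≤ n := by exact_mod_cast hn
    have hstep : 9 * ((32 * ((n : ℝ) + 1) ^ 2 - 96 * (n + 1)) / 3 + 16)
        ≤ 25 * ((32 * (n : ℝ) ^ 2 - 96 * n) / 3 + 16) := by nlinarith
    push_cast
    calc (9 : ℝ) ^ (n + 1) * ((32 * ((n : ℝ) + 1) ^ 2 - 96 * (n + 1)) / 3 + 16)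
        = 9 ^ n * (9 * ((32 * ((n : ℝ) + 1) ^ 2 - 96 * (n + 1)) / 3 + 16)) := by ring
      _ ≤ 9 ^ n * (25 * ((32 * (n : ℝ) ^ 2 - 96 * n) / 3 + 16)) := by gcongr
      _ = 25 * (9 ^ n * ((32 * (n : ℝ) ^ 2 - 96 * n) / 3 + 16)) := by ring
      _ ≤ 25 * 25 ^ n := by gcongr
      _ = 25 ^ (n + 1) := by ring

theorem cubic_le_nine_pow {n : ℕ} (hn : 5 ≤ n) :
    48 * (n : ℝ) * (2 * n - 1) + 48 * n + 64 * n * (2 * n - 1) * (2 * n - 2) ≤ 9 ^ n := by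
  induction n, hn using Nat.le_induction with
  | base => norm_num
  | succ n hn ih =>
    have hn' : (0 : ℝ) ≤ n - 5 := sub_nonneg.2 (by exact_mod_cast hn)
    rw [pow_succ]
    push_cast
    nlinarith [pow_nonneg hn' 2, pow_nonneg hn' 3]

/-- The second derivative of `defectRatio` as a function of `1 / (2 * cosh a)`, up to a negative
factor. Its sign is the analytic core of the replacement of an ensemble by a single state. -/
def defectCurvature (a : ℝ) : ℝ :=
  sinh a ^ 4 * cosh a - 3 * sinh a ^ 2 * cosh a - 6 * a ^ 2 * sinh a ^ 2 * cosh a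
    + 10 * a * sinh a ^ 3 + 6 * a * sinh a - 2 * a ^ 3 * sinh a - 3 * a ^ 2 * cosh a

theorem cosh_five_mul (a : ℝ) :
    cosh (5 * a) = cosh a * (16 * sinh a ^ 4 + 12 * sinh a ^ 2 + 1) := by
  rw [show 5 * a = 3 * a + 2 * a by ring, cosh_add, cosh_three_mul, sinh_three_mul, cosh_two_mul,
    sinh_two_mul]
  linear_combination (4 * cosh a ^ 3 + 8 * cosh a * sinh a ^ 2 + cosh a) * cosh_sq a

theorem defectCurvature_eq (a : ℝ) :
    defectCurvature a = 1 / 16 * cosh (5 * a) - 15 / 16 * cosh (3 * a) + 7 / 8 * cosh (1 * a)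
      - 3 / 2 * (a ^ 2 * cosh (3 * a)) - 3 / 2 * (a ^ 2 * cosh (1 * a))
      + 5 / 2 * (a * sinh (3 * a)) - 3 / 2 * (a * sinh (1 * a))
      - 2 * (a ^ 3 * sinh (1 * a)) := by
  rw [defectCurvature, cosh_five_mul, cosh_three_mul, sinh_three_mul, one_mul]
  linear_combination (15 / 4 + 6 * a ^ 2) * cosh a * cosh_sq a

theorem defectCurvature_coeff_nonneg (n : ℕ) :
    0 ≤ (25 : ℝ) ^ n / 16 - 15 / 16 * 9 ^ n + 7 / 8 - 3 / 2 * (2 * n * (2 * n - 1) * 9 ^ n / 9)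
      - 3 / 2 * (2 * n * (2 * n - 1)) + 5 / 2 * (2 * n * 9 ^ n / 3) - 3 / 2 * (2 * n)
      - 2 * (2 * n * (2 * n - 1) * (2 * n - 2)) := by
  rcases lt_or_ge n 5 with hn | hn
  · interval_cases n <;> norm_num
  · linarith [nine_pow_mul_le_twentyfive_pow hn, cubic_le_nine_pow hn]

theorem defectCurvature_nonneg (a : ℝ) : 0 ≤ defectCurvature a := by
  have hsum := (((((((((hasSum_cosh_mul 5 a).mul_left (1 / 16)).sub
    ((hasSum_cosh_mul 3 a).mul_left (15 / 16))).add ((hasSum_cosh_mul 1 a).mul_left (7 / 8))).sub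
    ((hasSum_sq_mul_cosh_mul three_ne_zero a).mul_left (3 / 2))).sub
    ((hasSum_sq_mul_cosh_mul one_ne_zero a).mul_left (3 / 2))).add
    ((hasSum_mul_sinh_mul three_ne_zero a).mul_left (5 / 2))).sub
    ((hasSum_mul_sinh_mul one_ne_zero a).mul_left (3 / 2))).sub
    ((hasSum_cube_mul_sinh_mul one_ne_zero a).mul_left 2))
  rw [← defectCurvature_eq] at hsum
  refine hsum.nonneg fun n => ?_
  have hpow : 0 ≤ a ^ (2 * n) / (2 * n).factorial := by
    rw [pow_mul]
    positivity
  refine (mul_nonneg (defectCurvature_coeff_nonneg n) hpow).trans_eq ?_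
  rw [pow_mul 5, pow_mul 3, one_pow]
  norm_num
  ring

end Hyperbolic

/-! ### The rapidity of a qubit state -/

section Rapidity

variable {x a : ℝ}

/-- The `a > 0` with `x = 1 / (2 * cosh a)`. A qubit state of determinant `x ^ 2` has eigenvalues
`exp a * x` and `exp (-a) * x`, and its Bloch vector has length `tanh a`. -/
def rapidity (x : ℝ) : ℝ := arcosh (1 / (2 * x))

theorem one_lt_one_div_two_mul (hx : x ∈ Ioo (0 : ℝ) (1 / 2)) : 1 < 1 / (2 * x) := by
  rw [lt_div_iff₀ (mul_pos two_pos hx.1)]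
  linarith [hx.2]

theorem rapidity_pos (hx : x ∈ Ioo (0 : ℝ) (1 / 2)) : 0 < rapidity x :=
  arcosh_pos (one_lt_one_div_two_mul hx)

theorem mapsTo_rapidity : MapsTo rapidity (Ioo (0 : ℝ) (1 / 2)) (Ioi 0) := fun _ => rapidity_pos

theorem cosh_rapidity (hx : x ∈ Ioo (0 : ℝ) (1 / 2)) : cosh (rapidity x) = 1 / (2 * x) :=
  cosh_arcosh (one_lt_one_div_two_mul hx).le

theorem sinh_rapidity_pos (hx : x ∈ Ioo (0 : ℝ) (1 / 2)) : 0 < sinh (rapidity x) :=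
  sinh_pos_iff.2 (rapidity_pos hx)

theorem one_div_two_mul_cosh_rapidity (hx : x ∈ Ioo (0 : ℝ) (1 / 2)) :
    1 / (2 * cosh (rapidity x)) = x := by
  rw [cosh_rapidity hx]
  field_simp

theorem hasDerivAt_rapidity (hx : x ∈ Ioo (0 : ℝ) (1 / 2)) :
    HasDerivAt rapidity (-(2 * cosh (rapidity x) ^ 2 / sinh (rapidity x))) x := by
  have hx0 : x ≠ 0 := hx.1.ne'
  have hinv : HasDerivAt (fun x : ℝ => 1 / (2 * x)) (-(2 * (1 / (2 * x)) ^ 2)) x := by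
    refine ((hasDerivAt_const x 1).fun_div ((hasDerivAt_id' x).const_mul 2)
      (by simpa using hx0)).congr_deriv ?_
    field_simp
    ring
  refine ((hasDerivAt_arcosh (one_lt_one_div_two_mul hx)).comp x hinv).congr_deriv ?_
  rw [← sinh_arcosh (one_lt_one_div_two_mul hx).le, cosh_rapidity hx, rapidity]
  ring

theorem rapidity_antitoneOn : AntitoneOn rapidity (Ioo (0 : ℝ) (1 / 2)) := fun x hx y hy hxy => by
  have hx0 := hx.1
  refine (arcosh_le_arcosh (zero_lt_one.trans (one_lt_one_div_two_mul hy))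
    (zero_lt_one.trans (one_lt_one_div_two_mul hx))).2 ?_
  gcongr

/-- For a qubit state of determinant `x ^ 2` and rapidity `a`, the derivative of the entropy with
respect to the determinant is `1 / (x * slopeRatio a)`. -/
def slopeRatio (a : ℝ) : ℝ := sinh a / a

/-- For a qubit state of determinant `x ^ 2` and rapidity `a`, the number `x * defectRatio a`
measures how much less concave the entropy is than the square root of the determinant; see
`detDefect`. -/
def defectRatio (a : ℝ) : ℝ := (a * cosh a - sinh a) / (sinh a * cosh a - a)

theorem hasDerivAt_slopeRatio (ha : 0 < a) :
    HasDerivAt slopeRatio ((a * cosh a - sinh a) / a ^ 2) a := by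
  refine ((hasDerivAt_sinh a).fun_div (hasDerivAt_id' a) ha.ne').congr_deriv ?_
  ring

theorem hasDerivAt_defectRatio (ha : 0 < a) :
    HasDerivAt defectRatio
      (-(sinh a * (a ^ 2 + a * sinh a * cosh a - 2 * sinh a ^ 2) / (sinh a * cosh a - a) ^ 2))
      a := by
  refine ((hasDerivAt_mul_cosh_sub_sinh a).fun_div (hasDerivAt_sinh_mul_cosh_sub a)
    (sub_pos.2 (lt_sinh_mul_cosh ha)).ne').congr_deriv ?_
  ring

theorem slopeRatio_monotoneOn : MonotoneOn slopeRatio (Ioi 0) :=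
  monotoneOn_of_hasDerivAt_nonneg (convex_Ioi 0) (fun _ => hasDerivAt_slopeRatio) fun a ha =>
    div_nonneg (sub_nonneg.2 (sinh_lt_mul_cosh ha).le) (sq_nonneg a)

theorem defectRatio_antitoneOn : AntitoneOn defectRatio (Ioi 0) :=
  antitoneOn_of_hasDerivAt_nonpos (convex_Ioi 0) (fun _ => hasDerivAt_defectRatio) fun a ha => by
    have := sub_nonneg.2 (two_mul_sinh_sq_le (le_of_lt ha))
    have := sinh_pos_iff.2 ha
    rw [neg_nonpos]
    positivity

theorem monotoneOn_mul_cosh_sub_sinh_div_cube :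
    MonotoneOn (fun a => (a * cosh a - sinh a) / a ^ 3) (Ioi 0) := by
  refine monotoneOn_of_hasDerivAt_nonneg (convex_Ioi 0)
    (fun a (ha : 0 < a) => ((hasDerivAt_mul_cosh_sub_sinh a).fun_div
      ((hasDerivAt_id' a).fun_pow 3) (by positivity))) fun a (ha : 0 < a) => ?_
  have := mul_nonneg (sq_nonneg a) (sub_nonneg.2 (three_mul_mul_cosh_sub_sinh_le ha.le))
  refine div_nonneg ?_ (by positivity)
  convert! this using 1
  norm_num
  ring

theorem monotoneOn_mul_cosh_div_sinh : MonotoneOn (fun a => a * cosh a / sinh a) (Ioi 0) := by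
  refine monotoneOn_of_hasDerivAt_nonneg (convex_Ioi 0)
    (fun a ha => ((hasDerivAt_id' a).fun_mul (hasDerivAt_cosh a)).fun_div (hasDerivAt_sinh a)
      (sinh_pos_iff.2 ha).ne') fun a ha => div_nonneg ?_ (sq_nonneg _)
  linear_combination lt_sinh_mul_cosh ha + a * cosh_sq a

theorem monotoneOn_slopeRatio_deriv :
    MonotoneOn (fun a => cosh a ^ 2 * (a * cosh a - sinh a) / (a ^ 2 * sinh a)) (Ioi 0) := by
  have hcosh : MonotoneOn cosh (Ioi 0) := fun a (ha : 0 < a) b (hb : 0 < b) hab =>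
    cosh_le_cosh.2 (by rwa [abs_of_pos ha, abs_of_pos hb])
  have hcube (a : ℝ) (ha : a ∈ Ioi 0) : 0 ≤ (a * cosh a - sinh a) / a ^ 3 :=
    div_nonneg (sub_nonneg.2 (sinh_lt_mul_cosh ha).le) (pow_nonneg (le_of_lt ha) 3)
  have hcoth (a : ℝ) (ha : a ∈ Ioi 0) : 0 ≤ a * cosh a / sinh a :=
    div_nonneg (mul_nonneg (le_of_lt ha) (cosh_pos a).le) (sinh_pos_iff.2 ha).le
  refine (((monotoneOn_mul_cosh_sub_sinh_div_cube.mul monotoneOn_mul_cosh_div_sinh hcube hcoth).mul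
    hcosh (fun a ha => mul_nonneg (hcube a ha) (hcoth a ha)) fun a _ => (cosh_pos a).le)).congr
    fun a (ha : 0 < a) => ?_
  have := sinh_pos_iff.2 ha
  simp only [Pi.mul_apply]
  field_simp

theorem hasDerivAt_defectRatio_deriv (ha : 0 < a) :
    HasDerivAt (fun a => cosh a ^ 2 * (a ^ 2 + a * sinh a * cosh a - 2 * sinh a ^ 2) /
      (sinh a * cosh a - a) ^ 2) (cosh a * defectCurvature a / (sinh a * cosh a - a) ^ 3) a := by
  have hne : sinh a * cosh a - a ≠ 0 := (sub_pos.2 (lt_sinh_mul_cosh ha)).ne'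
  refine ((((hasDerivAt_cosh a).fun_pow 2).fun_mul ((((hasDerivAt_id' a).fun_pow 2).fun_add
    (((hasDerivAt_id' a).fun_mul (hasDerivAt_sinh a)).fun_mul (hasDerivAt_cosh a))).fun_sub
    (((hasDerivAt_sinh a).fun_pow 2).const_mul 2))).fun_div
    ((hasDerivAt_sinh_mul_cosh_sub a).fun_pow 2) (pow_ne_zero 2 hne)).congr_deriv ?_
  rw [defectCurvature, div_eq_div_iff (by positivity) (by positivity)]
  linear_combination (sinh a * cosh a - a) ^ 4 * cosh a * (a * sinh a * (cosh a ^ 2 + 6) -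
    (a ^ 2 + 3 * sinh a ^ 2) * cosh a) * cosh_sq a

theorem monotoneOn_defectRatio_deriv :
    MonotoneOn (fun a => cosh a ^ 2 * (a ^ 2 + a * sinh a * cosh a - 2 * sinh a ^ 2) /
      (sinh a * cosh a - a) ^ 2) (Ioi 0) :=
  monotoneOn_of_hasDerivAt_nonneg (convex_Ioi 0) (fun _ => hasDerivAt_defectRatio_deriv)
    fun a ha => div_nonneg (mul_nonneg (cosh_pos a).le (defectCurvature_nonneg a))
      (pow_nonneg (sub_nonneg.2 (lt_sinh_mul_cosh ha).le) 3)

theorem slopeRatio_rapidity_antitoneOn :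
    AntitoneOn (fun x => slopeRatio (rapidity x)) (Ioo 0 (1 / 2)) :=
  slopeRatio_monotoneOn.comp_AntitoneOn rapidity_antitoneOn mapsTo_rapidity

theorem defectRatio_rapidity_monotoneOn :
    MonotoneOn (fun x => defectRatio (rapidity x)) (Ioo 0 (1 / 2)) :=
  defectRatio_antitoneOn.comp rapidity_antitoneOn mapsTo_rapidity

theorem slopeRatio_rapidity_convexOn :
    ConvexOn ℝ (Ioo 0 (1 / 2)) fun x => slopeRatio (rapidity x) := by
  refine convexOn_of_hasDerivAt_monotoneOn (convex_Ioo _ _) isOpen_Ioo (F' := fun x =>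
    -2 * (cosh (rapidity x) ^ 2 * (rapidity x * cosh (rapidity x) - sinh (rapidity x)) /
      (rapidity x ^ 2 * sinh (rapidity x)))) (fun x hx => ?_)
    fun x hx y hy hxy => mul_le_mul_of_nonpos_left ((monotoneOn_slopeRatio_deriv.comp_AntitoneOn
      rapidity_antitoneOn mapsTo_rapidity) hx hy hxy) (by norm_num)
  have := sinh_rapidity_pos hx
  refine ((hasDerivAt_slopeRatio (rapidity_pos hx)).comp x (hasDerivAt_rapidity hx)).congr_deriv ?_
  field_simp

theorem defectRatio_rapidity_concaveOn :
    ConcaveOn ℝ (Ioo 0 (1 / 2)) fun x => defectRatio (rapidity x) := by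
  refine concaveOn_of_hasDerivAt_antitoneOn (convex_Ioo _ _) isOpen_Ioo (F' := fun x =>
    2 * (cosh (rapidity x) ^ 2 * (rapidity x ^ 2 + rapidity x * sinh (rapidity x) *
      cosh (rapidity x) - 2 * sinh (rapidity x) ^ 2) /
      (sinh (rapidity x) * cosh (rapidity x) - rapidity x) ^ 2)) (fun x hx => ?_)
    fun x hx y hy hxy => mul_le_mul_of_nonneg_left ((monotoneOn_defectRatio_deriv.comp_AntitoneOn
      rapidity_antitoneOn mapsTo_rapidity) hx hy hxy) zero_le_two
  have := sinh_rapidity_pos hx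
  have := (sub_pos.2 (lt_sinh_mul_cosh (rapidity_pos hx))).ne'
  refine ((hasDerivAt_defectRatio (rapidity_pos hx)).comp x (hasDerivAt_rapidity hx)).congr_deriv ?_
  field_simp

end Rapidity

/-! ### The entropy of a qubit state as a function of its determinant -/

section DetEntropy

variable {a c D P K V X : ℝ}

/-- The entropy (in nats) of a qubit state of determinant `D`. -/
def detEntropy (D : ℝ) : ℝ := binEntropy ((1 + √(1 - 4 * D)) / 2)

/-- The derivative of `detEntropy`. -/
def detSlope (D : ℝ) : ℝ := 1 / (√D * slopeRatio (rapidity √D))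

/-- The curvature defect of `detEntropy`, measuring how much less concave `detEntropy` is than
the square root: its derivative satisfies `detSlope' = -detSlope / (detDefect + 2 D)`, whereas
the derivative of the square root satisfies this equation with defect zero. -/
def detDefect (D : ℝ) : ℝ := √D * defectRatio (rapidity √D)

theorem sqrt_mem_Ioo (hD : D ∈ Ioo (0 : ℝ) (1 / 4)) : √D ∈ Ioo (0 : ℝ) (1 / 2) :=
  ⟨sqrt_pos.2 hD.1, (sqrt_lt' (by norm_num)).2 (hD.2.trans_eq (by norm_num))⟩

theorem slopeRatio_pos (ha : 0 < a) : 0 < slopeRatio a := div_pos (sinh_pos_iff.2 ha) ha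

theorem defectRatio_pos (ha : 0 < a) : 0 < defectRatio a :=
  div_pos (sub_pos.2 (sinh_lt_mul_cosh ha)) (sub_pos.2 (lt_sinh_mul_cosh ha))

theorem detSlope_pos (hD : D ∈ Ioo (0 : ℝ) (1 / 4)) : 0 < detSlope D :=
  one_div_pos.2 (mul_pos (sqrt_mem_Ioo hD).1 (slopeRatio_pos (rapidity_pos (sqrt_mem_Ioo hD))))

theorem detDefect_pos (hD : D ∈ Ioo (0 : ℝ) (1 / 4)) : 0 < detDefect D :=
  mul_pos (sqrt_mem_Ioo hD).1 (defectRatio_pos (rapidity_pos (sqrt_mem_Ioo hD)))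

theorem continuous_detEntropy : Continuous detEntropy := by
  unfold detEntropy
  fun_prop

theorem sqrt_one_sub_four_mul (hD : D ∈ Ioo (0 : ℝ) (1 / 4)) :
    √(1 - 4 * D) = tanh (rapidity √D) := by
  have hx := sqrt_mem_Ioo hD
  have hsinh := sinh_rapidity_pos hx
  have := cosh_pos (rapidity √D)
  rw [tanh_eq_sinh_div_cosh, sqrt_eq_iff_mul_self_eq_of_pos (by positivity)]
  calc sinh (rapidity √D) / cosh (rapidity √D) * (sinh (rapidity √D) / cosh (rapidity √D))
      = 1 - 4 * (1 / (2 * cosh (rapidity √D))) ^ 2 := by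
        field_simp
        linear_combination -4 * cosh_sq (rapidity √D)
    _ = 1 - 4 * D := by rw [one_div_two_mul_cosh_rapidity hx, sq_sqrt hD.1.le]

theorem detSlope_eq (hD : D ∈ Ioo (0 : ℝ) (1 / 4)) :
    detSlope D = 2 * rapidity √D * cosh (rapidity √D) / sinh (rapidity √D) := by
  have hx := sqrt_mem_Ioo hD
  have := sinh_rapidity_pos hx
  have := rapidity_pos hx
  calc detSlope D = 1 / (1 / (2 * cosh (rapidity √D)) * slopeRatio (rapidity √D)) := by
        rw [one_div_two_mul_cosh_rapidity hx, detSlope]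
    _ = 2 * rapidity √D * cosh (rapidity √D) / sinh (rapidity √D) := by
        rw [slopeRatio]
        field_simp

theorem hasDerivAt_detEntropy (hD : D ∈ Ioo (0 : ℝ) (1 / 4)) :
    HasDerivAt detEntropy (detSlope D) D := by
  have hbloch := sqrt_one_sub_four_mul hD
  have hsinh := sinh_rapidity_pos (sqrt_mem_Ioo hD)
  have hlt := tanh_lt_one (rapidity √D)
  have hgt := neg_one_lt_tanh (rapidity √D)
  have heigen : HasDerivAt (fun D : ℝ => (1 + √(1 - 4 * D)) / 2)
      (-4 / (2 * √(1 - 4 * D)) / 2) D := by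
    have := ((((hasDerivAt_id' D).const_mul 4).const_sub 1).sqrt
      (by linarith [hD.2])).const_add 1
    simpa using this.div_const 2
  have hlog : log (1 - (1 + tanh (rapidity √D)) / 2) - log ((1 + tanh (rapidity √D)) / 2) =
      -(2 * rapidity √D) := by
    have hartanh := artanh_eq_half_log ⟨hgt.le, hlt.le⟩
    rw [artanh_tanh, log_div (by linarith) (by linarith)] at hartanh
    rw [show 1 - (1 + tanh (rapidity √D)) / 2 = (1 - tanh (rapidity √D)) / 2 by ring,
      log_div (by linarith) two_ne_zero, log_div (by linarith) two_ne_zero]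
    linarith
  refine ((hasDerivAt_binEntropy (by rw [hbloch]; linarith)
    (by rw [hbloch]; linarith)).comp D heigen).congr_deriv ?_
  rw [hbloch, hlog, detSlope_eq hD, tanh_eq_sinh_div_cosh]
  field_simp
  ring

theorem hasDerivAt_rapidity_sqrt (hD : D ∈ Ioo (0 : ℝ) (1 / 4)) :
    HasDerivAt (fun D => rapidity √D) (-(2 * cosh (rapidity √D) ^ 3 / sinh (rapidity √D))) D := by
  refine ((hasDerivAt_rapidity (sqrt_mem_Ioo hD)).comp D (hasDerivAt_sqrt hD.1.ne')).congr_deriv ?_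
  rw [← cosh_rapidity (sqrt_mem_Ioo hD)]
  ring

theorem detDefect_add_two_mul (hD : D ∈ Ioo (0 : ℝ) (1 / 4)) :
    detDefect D + 2 * D = rapidity √D * sinh (rapidity √D) ^ 2 / (2 * cosh (rapidity √D) ^ 2 *
      (sinh (rapidity √D) * cosh (rapidity √D) - rapidity √D)) := by
  have hx := sqrt_mem_Ioo hD
  have hne := (sub_pos.2 (lt_sinh_mul_cosh (rapidity_pos hx))).ne'
  calc detDefect D + 2 * D = 1 / (2 * cosh (rapidity √D)) * defectRatio (rapidity √D) +
        2 * (1 / (2 * cosh (rapidity √D))) ^ 2 := by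
        rw [one_div_two_mul_cosh_rapidity hx, sq_sqrt hD.1.le, detDefect]
    _ = _ := by
        rw [defectRatio]
        generalize hw : sinh (rapidity √D) * cosh (rapidity √D) - rapidity √D = w at hne ⊢
        field_simp
        linear_combination rapidity √D * cosh_sq (rapidity √D) - hw

theorem hasDerivAt_detSlope (hD : D ∈ Ioo (0 : ℝ) (1 / 4)) :
    HasDerivAt detSlope (-(detSlope D / (detDefect D + 2 * D))) D := by
  have hx := sqrt_mem_Ioo hD
  have hsinh := sinh_rapidity_pos hx
  have hpos := rapidity_pos hx
  have hne := (sub_pos.2 (lt_sinh_mul_cosh hpos)).ne'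
  have hrap : HasDerivAt (fun a => 2 * a * cosh a / sinh a)
      (2 * (sinh (rapidity √D) * cosh (rapidity √D) - rapidity √D) / sinh (rapidity √D) ^ 2)
      (rapidity √D) := by
    refine ((((hasDerivAt_id' _).const_mul 2).fun_mul (hasDerivAt_cosh _)).fun_div
      (hasDerivAt_sinh _) hsinh.ne').congr_deriv ?_
    congr 1
    linear_combination (-2 * rapidity √D) * cosh_sq (rapidity √D)
  have heq : detSlope =ᶠ[nhds D]
      fun D => 2 * rapidity √D * cosh (rapidity √D) / sinh (rapidity √D) := by
    filter_upwards [isOpen_Ioo.mem_nhds hD] with y hy using detSlope_eq hy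
  refine ((hrap.comp D (hasDerivAt_rapidity_sqrt hD)).congr_of_eventuallyEq heq).congr_deriv ?_
  rw [detDefect_add_two_mul hD, detSlope_eq hD]
  field_simp

theorem contDiffAt_binEntropy {p : ℝ} {n : WithTop ℕ∞} (hp0 : p ≠ 0) (hp1 : p ≠ 1) :
    ContDiffAt ℝ n binEntropy p := by
  have hp1 : 1 - p ≠ 0 := sub_ne_zero.2 hp1.symm
  unfold binEntropy
  fun_prop (disch := simp [*])

theorem contDiffAt_detEntropy {n : WithTop ℕ∞} (hD : D ∈ Ioo (0 : ℝ) (1 / 4)) :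
    ContDiffAt ℝ n detEntropy D := by
  have hpos : 1 - 4 * D ≠ 0 := by linarith [hD.2]
  have hlt : √(1 - 4 * D) < 1 := (sqrt_lt' one_pos).2 (by linarith [hD.1])
  refine (contDiffAt_binEntropy (by positivity) (by linarith)).comp D ?_
  fun_prop (disch := assumption)

theorem detEntropy_strictMonoOn : StrictMonoOn detEntropy (Icc 0 (1 / 4)) :=
  strictMonoOn_of_hasDerivWithinAt_pos (convex_Icc _ _) continuous_detEntropy.continuousOn
    (fun _ hD => (hasDerivAt_detEntropy (interior_Icc (α := ℝ) ▸ hD)).hasDerivWithinAt)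
    fun _ hD => detSlope_pos (interior_Icc (α := ℝ) ▸ hD)

theorem detDefect_monotoneOn : MonotoneOn detDefect (Ioo 0 (1 / 4)) := fun _ hD D' hD' hle =>
  mul_le_mul (sqrt_le_sqrt hle)
    (defectRatio_rapidity_monotoneOn (sqrt_mem_Ioo hD) (sqrt_mem_Ioo hD') (sqrt_le_sqrt hle))
    (defectRatio_pos (rapidity_pos (sqrt_mem_Ioo hD))).le (sqrt_nonneg D')

theorem monotoneOn_cosh_mul_defectRatio :
    MonotoneOn (fun a => cosh a * (a * cosh a - sinh a) / (sinh a * cosh a - a)) (Ioi 0) := by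
  refine monotoneOn_of_hasDerivAt_nonneg (convex_Ioi 0) (fun a ha => ((hasDerivAt_cosh a).fun_mul
    (hasDerivAt_mul_cosh_sub_sinh a)).fun_div (hasDerivAt_sinh_mul_cosh_sub a)
    (sub_pos.2 (lt_sinh_mul_cosh ha)).ne') fun a ha => div_nonneg ?_ (sq_nonneg _)
  refine (mul_nonneg (sinh_pos_iff.2 ha).le
    (sub_nonneg.2 (two_mul_sq_mul_cosh_le (le_of_lt ha)))).trans_eq ?_
  ring

theorem detDefect_div_antitoneOn : AntitoneOn (fun D => detDefect D / D) (Ioo 0 (1 / 4)) := by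
  have heq (D : ℝ) (hD : D ∈ Ioo (0 : ℝ) (1 / 4)) : 2 * (cosh (rapidity √D) *
      (rapidity √D * cosh (rapidity √D) - sinh (rapidity √D)) /
      (sinh (rapidity √D) * cosh (rapidity √D) - rapidity √D)) = detDefect D / D := by
    have hx := sqrt_mem_Ioo hD
    calc _ = 2 * (cosh (rapidity √D) * defectRatio (rapidity √D)) := by rw [defectRatio]; ring
      _ = √D * defectRatio (rapidity √D) / √D ^ 2 := by
        rw [cosh_rapidity hx]
        have := hx.1.ne'
        field_simp
      _ = detDefect D / D := by rw [sq_sqrt hD.1.le, detDefect]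
  refine AntitoneOn.congr (fun D hD D' hD' hle => ?_) heq
  exact mul_le_mul_of_nonneg_left (monotoneOn_cosh_mul_defectRatio
    (rapidity_pos (sqrt_mem_Ioo hD')) (rapidity_pos (sqrt_mem_Ioo hD))
    (rapidity_antitoneOn (sqrt_mem_Ioo hD) (sqrt_mem_Ioo hD') (sqrt_le_sqrt hle))) zero_le_two

theorem mul_detDefect_le (hc : c ∈ Icc (0 : ℝ) 1) (hV : V ∈ Ioo (0 : ℝ) (1 / 4))
    (hX : X ∈ Ioo (0 : ℝ) (1 / 4)) (h : c * V ≤ X) : c * detDefect V ≤ detDefect X := by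
  have hpos := (detDefect_pos hV).le
  rcases le_total V X with hVX | hXV
  · exact (mul_le_of_le_one_left hpos hc.2).trans (detDefect_monotoneOn hV hX hVX)
  · have hratio := (div_le_div_iff₀ hV.1 hX.1).1 (detDefect_div_antitoneOn hX hV hXV)
    refine le_of_mul_le_mul_right ?_ hV.1
    calc c * detDefect V * V = detDefect V * (c * V) := by ring
      _ ≤ detDefect V * X := by gcongr
      _ ≤ detDefect X * V := hratio

theorem sq_sum_mul_le {ι : Type*} (s : Finset ι) {w f g : ι → ℝ} (hw : ∀ i ∈ s, 0 ≤ w i)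
    (hg : ∀ i ∈ s, 0 < g i) :
    (∑ i ∈ s, w i * f i) ^ 2 ≤ (∑ i ∈ s, w i * g i) * ∑ i ∈ s, w i * (f i ^ 2 / g i) :=
  Finset.sum_sq_le_sum_mul_sum_of_sq_le_mul s (fun i hi => mul_nonneg (hw i hi) (hg i hi).le)
    (fun i hi => mul_nonneg (hw i hi) (div_nonneg (sq_nonneg _) (hg i hi).le)) fun i hi => by
      have := (hg i hi).ne'
      refine le_of_eq ?_
      field_simp

theorem sq_div_detDefect_le (hc : c ∈ Ioc (0 : ℝ) 1) (hV : V ∈ Ioo (0 : ℝ) (1 / 4))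
    (hX : X ∈ Ioo (0 : ℝ) (1 / 4)) (hlt : c * V < X) :
    (c * P + K) ^ 2 / (detDefect X + 2 * X)
      ≤ c * (P ^ 2 / (detDefect V + 2 * V)) + K ^ 2 / (2 * (X - c * V)) := by
  have hdefect := mul_detDefect_le ⟨hc.1.le, hc.2⟩ hV hX hlt.le
  have hWV : 0 < detDefect V + 2 * V := by linarith [detDefect_pos hV, hV.1]
  have hWX : 0 < detDefect X + 2 * X := by linarith [detDefect_pos hX, hX.1]
  have he : 0 < 2 * (X - c * V) := by linarith
  have hc0 := hc.1
  have hcauchy := sq_sum_mul_le Finset.univ (w := ![c, 1]) (f := ![P, K])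
    (g := ![detDefect V + 2 * V, 2 * (X - c * V)])
    (by simp [Fin.forall_fin_two, hc0.le]) (by simp [Fin.forall_fin_two, *])
  simp only [Fin.sum_univ_two, Matrix.cons_val_zero, Matrix.cons_val_one, one_mul] at hcauchy
  rw [div_le_iff₀' hWX]
  exact hcauchy.trans (mul_le_mul_of_nonneg_right (by linarith) (by positivity))

end DetEntropy

/-! ### Comparison of three determinants -/

section ConvexWeights

variable {z η c k x y w : ℝ}

theorem mul_lt_of_sq_eq (hc : c ∈ Icc (0 : ℝ) 1) (hk : 0 < k) (hx : 0 ≤ x)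
    (h : x ^ 2 = c * y ^ 2 + k) : c * y < x := by
  refine lt_of_pow_lt_pow_left₀ 2 hx ?_
  have := mul_nonneg (mul_nonneg hc.1 (sub_nonneg.2 hc.2)) (sq_nonneg y)
  linarith

theorem le_of_sq_eq (hz : η ≤ z) (hx : 0 ≤ x) (hX : x ^ 2 = z * y ^ 2 + k)
    (hZ : w ^ 2 = η * y ^ 2 + k) : w ≤ x := by
  refine le_of_sq_le_sq ?_ hx
  rw [hX, hZ]
  gcongr

theorem sub_le_sub_mul_of_sq_eq (hz : η ≤ z) (hz1 : z + η = 1) (hk : 0 ≤ k) (hx : 0 ≤ x)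
    (hy : 0 < y) (hw : 0 ≤ w) (hX : x ^ 2 = z * y ^ 2 + k) (hZ : w ^ 2 = η * y ^ 2 + k) :
    x - w ≤ (z - η) * y := by
  have hsum : y ≤ x + w := by
    refine le_of_sq_le_sq ?_ (add_nonneg hx hw)
    linear_combination 2 * hk + 2 * mul_nonneg hx hw - hX - hZ - y ^ 2 * hz1
  refine le_of_mul_le_mul_left ?_ hy
  calc y * (x - w) ≤ (x + w) * (x - w) :=
        mul_le_mul_of_nonneg_right hsum (sub_nonneg.2 (le_of_sq_eq hz hx hX hZ))
    _ = y * ((z - η) * y) := by linear_combination hX - hZ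

theorem mul_le_mul_of_sq_eq (hη : 0 ≤ η) (hz : η ≤ z) (hk : 0 ≤ k)
    (hw : 0 ≤ w) (hX : x ^ 2 = z * y ^ 2 + k) (hZ : w ^ 2 = η * y ^ 2 + k) : η * x ≤ z * w := by
  refine le_of_sq_le_sq ?_ (mul_nonneg (hη.trans hz) hw)
  have : 0 ≤ (z - η) * (z * η * y ^ 2 + (z + η) * k) := by
    have := sub_nonneg.2 hz
    have := hη.trans hz
    positivity
  linear_combination this + η ^ 2 * hX - z ^ 2 * hZ

theorem weighted_mean_le_of_sq_eq (hz : η ≤ z) (hz1 : z + η = 1) (hk : 0 ≤ k) (hx : 0 ≤ x)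
    (hy : 0 < y) (hw : 0 ≤ w) (hX : x ^ 2 = z * y ^ 2 + k) (hZ : w ^ 2 = η * y ^ 2 + k) :
    w * (x - z * y) * w + y * (z * w - η * x) * y ≤ x * (w - η * y) * x := by
  have := mul_nonneg hk (sub_nonneg.2 (sub_le_sub_mul_of_sq_eq hz hz1 hk hx hy hw hX hZ))
  linear_combination this - (w - η * y) * hX + (x - z * y) * hZ

theorem add_mul_le_of_convexOn {s : Set ℝ} {F : ℝ → ℝ} (hF : ConvexOn ℝ s F)
    (hanti : AntitoneOn F s) {b c : ℝ} (hb : 0 ≤ b) (hc : 0 ≤ c) (hbc : 0 < b + c)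
    (h : b * w + c * y ≤ (b + c) * x) (hx : x ∈ s) (hy : y ∈ s) (hw : w ∈ s) :
    (b + c) * F x ≤ b * F w + c * F y := by
  have hsum : b / (b + c) + c / (b + c) = 1 := by rw [← add_div, div_self hbc.ne']
  have hmem := hF.1 hw hy (by positivity) (by positivity) hsum
  have hconv := hF.2 hw hy (by positivity) (by positivity) hsum
  simp only [smul_eq_mul] at hmem hconv
  have hle : b / (b + c) * w + c / (b + c) * y ≤ x := by
    rw [div_mul_eq_mul_div, div_mul_eq_mul_div, ← add_div, div_le_iff₀ hbc]
    linarith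
  calc (b + c) * F x ≤ (b + c) * (b / (b + c) * F w + c / (b + c) * F y) := by
        gcongr
        exact (hanti hmem hx hle).trans hconv
    _ = b * F w + c * F y := by field_simp

theorem three_point_of_convexOn {s : Set ℝ} {F : ℝ → ℝ} (hF : ConvexOn ℝ s F)
    (hanti : AntitoneOn F s) (hη : 0 ≤ η) (hz : η ≤ z) (hz1 : z + η = 1) (hk : 0 < k)
    (hx0 : 0 < x) (hy0 : 0 < y) (hw0 : 0 < w) (hX : x ^ 2 = z * y ^ 2 + k)
    (hZ : w ^ 2 = η * y ^ 2 + k) (hx : x ∈ s) (hy : y ∈ s) (hw : w ∈ s) :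
    x * (w - η * y) * F x ≤ w * (x - z * y) * F w + y * (z * w - η * x) * F y := by
  have hwx := sub_pos.2 (mul_lt_of_sq_eq ⟨hη, by linarith⟩ hk hw0.le hZ)
  have hxz := sub_pos.2 (mul_lt_of_sq_eq ⟨hη.trans hz, by linarith⟩ hk hx0.le hX)
  have hzw := sub_nonneg.2 (mul_le_mul_of_sq_eq hη hz hk.le hw0.le hX hZ)
  have hsum : w * (x - z * y) + y * (z * w - η * x) = x * (w - η * y) := by ring
  have hmean := weighted_mean_le_of_sq_eq hz hz1 hk.le hx0.le hy0 hw0.le hX hZ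
  rw [← hsum] at hmean ⊢
  exact add_mul_le_of_convexOn hF hanti (by positivity) (by positivity) (hsum ▸ by positivity)
    hmean hx hy hw

end ConvexWeights

section ThreePoint

variable {c z η k D V X Y : ℝ}

theorem detSlope_antitoneOn : AntitoneOn detSlope (Ioo 0 (1 / 4)) :=
  antitoneOn_of_hasDerivAt_nonpos (convex_Ioo _ _) (fun _ => hasDerivAt_detSlope) fun D hD => by
    have := detSlope_pos hD
    have := detDefect_pos hD
    have := hD.1
    rw [neg_nonpos]
    positivity

theorem sqrt_mul_detSlope_monotoneOn : MonotoneOn (fun D => √D * detSlope D) (Ioo 0 (1 / 4)) := by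
  have heq (D : ℝ) (hD : D ∈ Ioo (0 : ℝ) (1 / 4)) :
      1 / slopeRatio (rapidity √D) = √D * detSlope D := by
    have := (sqrt_mem_Ioo hD).1.ne'
    rw [detSlope]
    field_simp
  refine MonotoneOn.congr (fun D hD D' hD' hle => ?_) heq
  exact one_div_le_one_div_of_le (slopeRatio_pos (rapidity_pos (sqrt_mem_Ioo hD')))
    (slopeRatio_rapidity_antitoneOn (sqrt_mem_Ioo hD) (sqrt_mem_Ioo hD') (sqrt_le_sqrt hle))

theorem mul_detSlope_lt (hc : c ∈ Ioo (0 : ℝ) 1) (hV : V ∈ Ioo (0 : ℝ) (1 / 4))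
    (hX : X ∈ Ioo (0 : ℝ) (1 / 4)) (h : c * V ≤ X) : c * detSlope X < detSlope V := by
  have hfX := detSlope_pos hX
  rcases le_total V X with hVX | hXV
  · exact (mul_lt_of_lt_one_left hfX hc.2).trans_le (detSlope_antitoneOn hV hX hVX)
  · have hsqrt : c * √V < √X := by
      refine lt_of_pow_lt_pow_left₀ 2 (sqrt_nonneg _) ?_
      rw [mul_pow, sq_sqrt hV.1.le, sq_sqrt hX.1.le]
      exact (mul_lt_mul_of_pos_right (pow_lt_self_of_lt_one₀ hc.1 hc.2 one_lt_two) hV.1).trans_le h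
    refine lt_of_mul_lt_mul_left ?_ (sqrt_nonneg V)
    calc √V * (c * detSlope X) = c * √V * detSlope X := by ring
      _ < √X * detSlope X := by gcongr
      _ ≤ √V * detSlope V := sqrt_mul_detSlope_monotoneOn hX hV hXV

theorem mul_detSlope_lt_mul (hη : 0 < η) (hz : η < z) (hk : 0 < k)
    (hX : z * Y + k ∈ Ioo (0 : ℝ) (1 / 4)) (hZ : η * Y + k ∈ Ioo (0 : ℝ) (1 / 4)) :
    η * detSlope (η * Y + k) < z * detSlope (z * Y + k) := by
  have hz0 := hη.trans hz
  have hlt := (div_lt_one hz0).2 hz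
  have h := mul_detSlope_lt (c := η / z) ⟨by positivity, hlt⟩ hX hZ (by
    calc η / z * (z * Y + k) = η * Y + η / z * k := by field_simp
      _ ≤ η * Y + k := by gcongr; exact mul_le_of_le_one_left hk.le hlt.le)
  rwa [div_mul_eq_mul_div, div_lt_iff₀' hz0] at h

/-- The excess of the reciprocal of `detSlope` over homogeneity under `D ↦ c * D + k`. -/
def slopeExcess (c k D : ℝ) : ℝ := 1 / detSlope (c * D + k) - c * (1 / detSlope D)

/-- The excess of `detDefect` over homogeneity under `D ↦ c * D + k`. -/
def defectExcess (c k D : ℝ) : ℝ := detDefect (c * D + k) - c * detDefect D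

theorem slopeExcess_pos (hc : c ∈ Ioo (0 : ℝ) 1) (hk : 0 ≤ k) (hD : D ∈ Ioo (0 : ℝ) (1 / 4))
    (hcD : c * D + k ∈ Ioo (0 : ℝ) (1 / 4)) : 0 < slopeExcess c k D := by
  rw [slopeExcess, sub_pos, mul_one_div, div_lt_div_iff₀ (detSlope_pos hD) (detSlope_pos hcD),
    one_mul]
  exact mul_detSlope_lt hc hD hcD (le_add_of_nonneg_right hk)

theorem defectExcess_nonneg (hc : c ∈ Icc (0 : ℝ) 1) (hk : 0 ≤ k) (hD : D ∈ Ioo (0 : ℝ) (1 / 4))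
    (hcD : c * D + k ∈ Ioo (0 : ℝ) (1 / 4)) : 0 ≤ defectExcess c k D :=
  sub_nonneg.2 (mul_detDefect_le hc hD hcD (le_add_of_nonneg_right hk))

theorem one_div_detSlope (D : ℝ) : 1 / detSlope D = √D * slopeRatio (rapidity √D) := by
  rw [detSlope, one_div_one_div]

theorem slopeExcess_mul_le (hη : 0 < η) (hz : η < z) (hz1 : z + η = 1) (hk : 0 < k)
    (hY : Y ∈ Ioo (0 : ℝ) (1 / 4)) (hX : z * Y + k ∈ Ioo (0 : ℝ) (1 / 4))
    (hZ : η * Y + k ∈ Ioo (0 : ℝ) (1 / 4)) :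
    slopeExcess z k Y * (√(η * Y + k) - η * √Y) ≤
      slopeExcess η k Y * (√(z * Y + k) - z * √Y) := by
  have h := three_point_of_convexOn slopeRatio_rapidity_convexOn slopeRatio_rapidity_antitoneOn
    hη.le hz.le hz1 hk (sqrt_pos.2 hX.1) (sqrt_pos.2 hY.1) (sqrt_pos.2 hZ.1)
    (by rw [sq_sqrt hX.1.le, sq_sqrt hY.1.le]) (by rw [sq_sqrt hZ.1.le, sq_sqrt hY.1.le])
    (sqrt_mem_Ioo hX) (sqrt_mem_Ioo hY) (sqrt_mem_Ioo hZ)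
  simp only [slopeExcess, one_div_detSlope]
  linear_combination h

theorem defectExcess_mul_le (hη : 0 < η) (hz : η < z) (hz1 : z + η = 1) (hk : 0 < k)
    (hY : Y ∈ Ioo (0 : ℝ) (1 / 4)) (hX : z * Y + k ∈ Ioo (0 : ℝ) (1 / 4))
    (hZ : η * Y + k ∈ Ioo (0 : ℝ) (1 / 4)) :
    defectExcess η k Y * (√(z * Y + k) - z * √Y) ≤
      defectExcess z k Y * (√(η * Y + k) - η * √Y) := by
  have h := three_point_of_convexOn defectRatio_rapidity_concaveOn.neg
    defectRatio_rapidity_monotoneOn.neg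
    hη.le hz.le hz1 hk (sqrt_pos.2 hX.1) (sqrt_pos.2 hY.1) (sqrt_pos.2 hZ.1)
    (by rw [sq_sqrt hX.1.le, sq_sqrt hY.1.le]) (by rw [sq_sqrt hZ.1.le, sq_sqrt hY.1.le])
    (sqrt_mem_Ioo hX) (sqrt_mem_Ioo hY) (sqrt_mem_Ioo hZ)
  simp only [Pi.neg_apply] at h
  simp only [defectExcess, detDefect]
  linear_combination h

theorem slopeExcess_le (hη : 0 < η) (hz : η < z) (hz1 : z + η = 1) (hk : 0 < k)
    (hY : Y ∈ Ioo (0 : ℝ) (1 / 4)) (hX : z * Y + k ∈ Ioo (0 : ℝ) (1 / 4))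
    (hZ : η * Y + k ∈ Ioo (0 : ℝ) (1 / 4)) : slopeExcess z k Y ≤ slopeExcess η k Y := by
  have hsqX : √(z * Y + k) ^ 2 = z * √Y ^ 2 + k := by rw [sq_sqrt hX.1.le, sq_sqrt hY.1.le]
  have hsqZ : √(η * Y + k) ^ 2 = η * √Y ^ 2 + k := by rw [sq_sqrt hZ.1.le, sq_sqrt hY.1.le]
  have hgap : √(z * Y + k) - z * √Y ≤ √(η * Y + k) - η * √Y := by
    linear_combination sub_le_sub_mul_of_sq_eq hz.le hz1 hk.le (sqrt_nonneg _) (sqrt_pos.2 hY.1)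
      (sqrt_nonneg _) hsqX hsqZ
  refine le_of_mul_le_mul_right ?_
    (sub_pos.2 (mul_lt_of_sq_eq ⟨hη.le, by linarith⟩ hk (sqrt_nonneg _) hsqZ))
  exact (slopeExcess_mul_le hη hz hz1 hk hY hX hZ).trans
    (mul_le_mul_of_nonneg_left hgap (slopeExcess_pos ⟨hη, by linarith⟩ hk.le hY hZ).le)

theorem slopeExcess_mul_defectExcess_le (hη : 0 < η) (hz : η < z) (hz1 : z + η = 1) (hk : 0 < k)
    (hY : Y ∈ Ioo (0 : ℝ) (1 / 4)) (hX : z * Y + k ∈ Ioo (0 : ℝ) (1 / 4))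
    (hZ : η * Y + k ∈ Ioo (0 : ℝ) (1 / 4)) :
    slopeExcess z k Y * defectExcess η k Y ≤ slopeExcess η k Y * defectExcess z k Y := by
  have hsqZ : √(η * Y + k) ^ 2 = η * √Y ^ 2 + k := by rw [sq_sqrt hZ.1.le, sq_sqrt hY.1.le]
  refine le_of_mul_le_mul_right ?_
    (sub_pos.2 (mul_lt_of_sq_eq ⟨hη.le, by linarith⟩ hk (sqrt_nonneg _) hsqZ))
  have hdefect := defectExcess_nonneg ⟨hη.le, by linarith⟩ hk.le hY hZ
  have hslope := (slopeExcess_pos ⟨hη, by linarith⟩ hk.le hY hZ).le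
  calc slopeExcess z k Y * defectExcess η k Y * (√(η * Y + k) - η * √Y)
      = defectExcess η k Y * (slopeExcess z k Y * (√(η * Y + k) - η * √Y)) := by ring
    _ ≤ defectExcess η k Y * (slopeExcess η k Y * (√(z * Y + k) - z * √Y)) := by
        gcongr defectExcess η k Y * ?_
        exact slopeExcess_mul_le hη hz hz1 hk hY hX hZ
    _ = slopeExcess η k Y * (defectExcess η k Y * (√(z * Y + k) - z * √Y)) := by ring
    _ ≤ slopeExcess η k Y * (defectExcess z k Y * (√(η * Y + k) - η * √Y)) := by
        gcongr slopeExcess η k Y * ?_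
        exact defectExcess_mul_le hη hz hz1 hk hY hX hZ
    _ = slopeExcess η k Y * defectExcess z k Y * (√(η * Y + k) - η * √Y) := by ring

theorem mul_slopeExcess_lt_mul (hη : 0 < η) (hz : η < z) (hk : 0 < k)
    (hX : z * Y + k ∈ Ioo (0 : ℝ) (1 / 4)) (hZ : η * Y + k ∈ Ioo (0 : ℝ) (1 / 4)) :
    η * slopeExcess z k Y < z * slopeExcess η k Y := by
  have hdiff : z * slopeExcess η k Y - η * slopeExcess z k Y =
      z / detSlope (η * Y + k) - η / detSlope (z * Y + k) := by
    rw [slopeExcess, slopeExcess]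
    ring
  rw [← sub_pos, hdiff, sub_pos, div_lt_div_iff₀ (detSlope_pos hX) (detSlope_pos hZ)]
  exact mul_detSlope_lt_mul hη hz hk hX hZ

theorem lagrangian_nonpos {A B C Wx Wy Wz P K T : ℝ} (hA : 0 ≤ A) (hB : 0 < B) (hBC : B ≤ C)
    (hABC : A + η * B = z * C) (hk : 0 < k) (hx : 0 < Wx) (hy : 0 < Wy) (hz : 0 < Wz)
    (h : A * Wy + B * Wz + (C - B) * (2 * k) ≤ C * Wx) :
    A * (T - P ^ 2 / Wy) + B * (η * T + K ^ 2 / (2 * k) - (η * P + K) ^ 2 / Wz)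
      - C * (z * T + K ^ 2 / (2 * k) - (z * P + K) ^ 2 / Wx) ≤ 0 := by
  have hC : 0 < C := hB.trans_le hBC
  have hcauchy := sq_sum_mul_le Finset.univ (w := ![A, B, C - B]) (f := ![P, η * P + K, K])
    (g := ![Wy, Wz, 2 * k]) (by simp [Fin.forall_fin_succ, hA, hB.le, hBC])
    (by simp [Fin.forall_fin_succ, *])
  simp only [Fin.sum_univ_three, Matrix.cons_val] at hcauchy
  have hmean : A * P + B * (η * P + K) + (C - B) * K = C * (z * P + K) := by
    linear_combination P * hABC
  have hE := sub_nonneg.2 hBC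
  rw [hmean] at hcauchy
  have hsq : C * ((z * P + K) ^ 2 / Wx) ≤
      A * (P ^ 2 / Wy) + B * ((η * P + K) ^ 2 / Wz) + (C - B) * (K ^ 2 / (2 * k)) := by
    rw [← mul_div_assoc, div_le_iff₀' hx]
    refine le_of_mul_le_mul_left ?_ hC
    calc C * (C * (z * P + K) ^ 2) = (C * (z * P + K)) ^ 2 := by ring
      _ ≤ _ := hcauchy.trans (mul_le_mul_of_nonneg_right h (by positivity))
      _ = _ := by ring
  linear_combination hsq + T * hABC

/-- The second derivative of `detEntropy` along a curve of determinants with value `D`, velocity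
`D'` and acceleration `D''`. -/
def detEntropyAccel (D D' D'' : ℝ) : ℝ := detSlope D * (D'' - D' ^ 2 / (detDefect D + 2 * D))

theorem detDefect_add_two_mul_pos (hD : D ∈ Ioo (0 : ℝ) (1 / 4)) : 0 < detDefect D + 2 * D :=
  add_pos (detDefect_pos hD) (mul_pos two_pos hD.1)

/-- Lagrange multipliers: `slopeExcess z k Y` and `slopeExcess η k Y` are proportional to the
multipliers for which a combination of the three accelerations is nonpositive. -/
theorem detEntropyAccel_le_of_eq (hη : 0 < η) (hz : η < z) (hz1 : z + η = 1) (hk : 0 < k)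
    (hY : Y ∈ Ioo (0 : ℝ) (1 / 4)) (hX : z * Y + k ∈ Ioo (0 : ℝ) (1 / 4))
    (hZ : η * Y + k ∈ Ioo (0 : ℝ) (1 / 4)) {P K T : ℝ}
    (heq : detEntropyAccel (z * Y + k) (z * P + K) (z * T + K ^ 2 / (2 * k)) =
      detEntropyAccel (η * Y + k) (η * P + K) (η * T + K ^ 2 / (2 * k))) :
    detEntropyAccel Y P T ≤
      detEntropyAccel (z * Y + k) (z * P + K) (z * T + K ^ 2 / (2 * k)) := by
  have hfY := detSlope_pos hY
  have hfX := detSlope_pos hX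
  have hfZ := detSlope_pos hZ
  have hB := slopeExcess_pos (c := z) ⟨hη.trans hz, by linarith⟩ hk.le hY hX
  have hA := sub_pos.2 (mul_slopeExcess_lt_mul hη hz hk hX hZ)
  have hdefect := slopeExcess_mul_defectExcess_le hη hz hz1 hk hY hX hZ
  have hL := lagrangian_nonpos (P := P) (K := K) (T := T) hA.le hB
    (slopeExcess_le hη hz hz1 hk hY hX hZ) (sub_add_cancel _ _) hk
    (detDefect_add_two_mul_pos hX) (detDefect_add_two_mul_pos hY) (detDefect_add_two_mul_pos hZ)
    (by rw [defectExcess, defectExcess] at hdefect; linear_combination hdefect)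
  simp only [detEntropyAccel] at heq ⊢
  generalize z * T + K ^ 2 / (2 * k) -
    (z * P + K) ^ 2 / (detDefect (z * Y + k) + 2 * (z * Y + k)) = uX at *
  generalize η * T + K ^ 2 / (2 * k) -
    (η * P + K) ^ 2 / (detDefect (η * Y + k) + 2 * (η * Y + k)) = uZ at *
  generalize T - P ^ 2 / (detDefect Y + 2 * Y) = uY at *
  obtain rfl : uZ = detSlope (z * Y + k) * uX / detSlope (η * Y + k) :=
    (eq_div_iff hfZ.ne').2 (by rw [heq, mul_comm])
  refine sub_nonpos.1 (nonpos_of_mul_nonpos_right ?_ hA)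
  refine (mul_nonpos_of_nonneg_of_nonpos hfY.le hL).trans_eq' ?_
  rw [slopeExcess, slopeExcess]
  field_simp
  ring

end ThreePoint

/-! ### Jensen's inequality along level curves -/

section SecondDerivative

variable {f g : ℝ → ℝ} {t : ℝ}

theorem differentiableAt_deriv_of_contDiffAt (hf : ContDiffAt ℝ 2 f t) :
    DifferentiableAt ℝ (deriv f) t :=
  (ContDiffAt.derivWithin (m := 1) hf (by norm_num)).differentiableAt (by norm_num)

theorem concaveOn_of_deriv_deriv_nonpos {s : Set ℝ} (hs : Convex ℝ s)
    (hf : ∀ t ∈ s, ContDiffAt ℝ 2 f t) (hf'' : ∀ t ∈ s, deriv (deriv f) t ≤ 0) :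
    ConcaveOn ℝ s f :=
  concaveOn_of_deriv2_nonpos' hs
    (fun t ht => ((hf t ht).differentiableAt (by norm_num)).differentiableWithinAt)
    (fun t ht => (differentiableAt_deriv_of_contDiffAt (hf t ht)).differentiableWithinAt) hf''

theorem concaveOn_of_comp_lineMap {E : Type*} [AddCommGroup E] [Module ℝ E] {s : Set E}
    {F : E → ℝ} (hs : Convex ℝ s)
    (h : ∀ x ∈ s, ∀ y ∈ s, ConcaveOn ℝ (Icc 0 1) fun t : ℝ => F (AffineMap.lineMap x y t)) :
    ConcaveOn ℝ s F := by
  refine ⟨hs, fun x hx y hy a b ha hb hab => ?_⟩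
  have := (h x hx y hy).2 (left_mem_Icc.2 zero_le_one) (right_mem_Icc.2 zero_le_one) ha hb hab
  simpa [AffineMap.lineMap_apply_module, ← eq_sub_of_add_eq hab] using this

theorem isInvertible_of_apply_one_ne_zero {L : ℝ →L[ℝ] ℝ} (hL : L 1 ≠ 0) : L.IsInvertible := by
  have hinv : L * ((L 1)⁻¹ • 1) = 1 ∧ ((L 1)⁻¹ • 1) * L = 1 := by
    constructor <;> ext <;> simp [hL]
  exact .of_inverse hinv.1 hinv.2

theorem fderiv_apply_zero_one {E : Type*} [NormedAddCommGroup E] [NormedSpace ℝ E] {F : E × ℝ → ℝ}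
    {x : E × ℝ} (hF : DifferentiableAt ℝ F x) :
    fderiv ℝ F x (0, 1) = deriv (fun Y => F (x.1, Y)) x.2 := by
  have hcurve : HasDerivAt (fun Y : ℝ => (x.1, Y)) (0, 1) x.2 :=
    (hasDerivAt_const _ _).prodMk (hasDerivAt_id _)
  exact (hF.hasFDerivAt.comp_hasDerivAt x.2 hcurve).deriv.symm

end SecondDerivative

/-- Pairs of an excited-state population `q` and a determinant `Y` of a mixed, full-rank qubit
state with nonzero coherence. -/
def mixedRegion : Set (ℝ × ℝ) := {x | 0 < x.1 ∧ x.1 < 1 ∧ 0 < x.2 ∧ x.2 < x.1 * (1 - x.1)}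

/-- Pairs of an excited-state population `q` and a determinant `Y` of a qubit state. -/
def stateRegion : Set (ℝ × ℝ) := {x | 0 ≤ x.1 ∧ x.1 ≤ 1 ∧ 0 ≤ x.2 ∧ x.2 ≤ x.1 * (1 - x.1)}

theorem mixedRegion_subset_stateRegion : mixedRegion ⊆ stateRegion :=
  fun _ ⟨h0, h1, h2, h3⟩ => ⟨h0.le, h1.le, h2.le, h3.le⟩

theorem isOpen_mixedRegion : IsOpen mixedRegion := by
  simp only [mixedRegion, ofPred_and]
  refine (isOpen_lt ?_ ?_).inter ((isOpen_lt ?_ ?_).inter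
    ((isOpen_lt ?_ ?_).inter (isOpen_lt ?_ ?_))) <;> fun_prop

theorem isClosed_stateRegion : IsClosed stateRegion := by
  simp only [stateRegion, ofPred_and]
  refine (isClosed_le ?_ ?_).inter ((isClosed_le ?_ ?_).inter
    ((isClosed_le ?_ ?_).inter (isClosed_le ?_ ?_))) <;> fun_prop

theorem snd_mem_Icc_of_mem_stateRegion {x : ℝ × ℝ} (hx : x ∈ stateRegion) :
    x.2 ∈ Icc (0 : ℝ) (1 / 4) :=
  ⟨hx.2.2.1, by linarith [hx.2.2.2, sq_nonneg (x.1 - 1 / 2)]⟩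

theorem openSegment_center_subset_mixedRegion {x : ℝ × ℝ} (hx : x ∈ stateRegion) :
    openSegment ℝ x (1 / 2, 1 / 8) ⊆ mixedRegion := by
  rintro _ ⟨a, b, ha, hb, hab, rfl⟩
  obtain ⟨h1, h2, h3, h4⟩ := hx
  obtain rfl : b = 1 - a := by linarith
  refine ⟨?_, ?_, ?_, ?_⟩ <;> simp only [Prod.smul_mk, Prod.fst_add, Prod.snd_add, Prod.smul_fst,
    Prod.smul_snd, smul_eq_mul]
  · positivity
  · linarith [mul_nonneg ha.le (sub_nonneg.2 h2)]
  · positivity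
  · linear_combination a * h4 + hb / 8
      + mul_nonneg (mul_nonneg ha.le hb.le) (sq_nonneg (x.1 - 1 / 2))

theorem stateRegion_subset_closure : stateRegion ⊆ closure mixedRegion := fun _ hx =>
  closure_mono (openSegment_center_subset_mixedRegion hx)
    (segment_subset_closure_openSegment (left_mem_segment ℝ _ _))

/-- A function of population and determinant that has regular level curves, graphs over the
population axis. The last two conditions make its range over each population interval convex. -/
structure LevelFunction (U : ℝ × ℝ → ℝ) : Prop where
  continuous : Continuous U
  contDiffAt : ∀ x ∈ mixedRegion, ContDiffAt ℝ 2 U x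
  deriv_pos : ∀ x ∈ mixedRegion, 0 < deriv (fun Y => U (x.1, Y)) x.2
  convexOn_bot : ConvexOn ℝ (Ioo 0 1) fun q => U (q, 0)
  concaveOn_top : ConcaveOn ℝ (Ioo 0 1) fun q => U (q, q * (1 - q))

/-- `V` is infinitesimally concave along every curve that is affine in the population and
affine, to second order, in the value of `U`. -/
structure ConcaveAlongLevels (U V : ℝ × ℝ → ℝ) : Prop where
  continuous : Continuous V
  contDiffAt : ∀ x ∈ mixedRegion, ContDiffAt ℝ 2 V x
  deriv_deriv_nonpos : ∀ (Q Y : ℝ → ℝ) (R t : ℝ), (∀ s, HasDerivAt Q R s) → ContDiffAt ℝ 2 Y t →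
    (Q t, Y t) ∈ mixedRegion → deriv (deriv fun s => U (Q s, Y s)) t = 0 →
    deriv (deriv fun s => V (Q s, Y s)) t ≤ 0

/-- The image of `mixedRegion` under `(q, Y) ↦ (q, U (q, Y))`. -/
def levelRegion (U : ℝ × ℝ → ℝ) : Set (ℝ × ℝ) :=
  {e | (e.1 ∈ Ioo (0 : ℝ) 1 ∧ U (e.1, 0) < e.2) ∧
    e.1 ∈ Ioo (0 : ℝ) 1 ∧ e.2 < U (e.1, e.1 * (1 - e.1))}

namespace LevelFunction

variable {U V : ℝ × ℝ → ℝ} (hU : LevelFunction U)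

include hU

theorem isOpen_levelRegion : IsOpen (levelRegion U) := by
  have := hU.continuous
  simp only [levelRegion, ofPred_and]
  refine ((isOpen_Ioo.preimage continuous_fst).inter (isOpen_lt ?_ ?_)).inter
    ((isOpen_Ioo.preimage continuous_fst).inter (isOpen_lt ?_ ?_)) <;> fun_prop

theorem convex_levelRegion : Convex ℝ (levelRegion U) :=
  hU.convexOn_bot.convex_strict_epigraph.inter hU.concaveOn_top.convex_strict_hypograph

theorem strictMonoOn_slice (q : ℝ) : StrictMonoOn (fun Y => U (q, Y)) (Icc 0 (q * (1 - q))) := by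
  have := hU.continuous
  refine strictMonoOn_of_deriv_pos (convex_Icc _ _) (by fun_prop) fun Y hY => ?_
  rw [interior_Icc] at hY
  obtain ⟨hq0, hq1⟩ : 0 < q ∧ q < 1 := by constructor <;> nlinarith [hY.1.trans hY.2]
  exact hU.deriv_pos (q, Y) ⟨hq0, hq1, hY.1, hY.2⟩

theorem eq_of_mem_mixedRegion {q Y Y' : ℝ} (hY : (q, Y) ∈ mixedRegion)
    (hY' : (q, Y') ∈ mixedRegion) (h : U (q, Y) = U (q, Y')) : Y = Y' :=
  (hU.strictMonoOn_slice q).injOn ⟨hY.2.2.1.le, hY.2.2.2.le⟩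
    ⟨hY'.2.2.1.le, hY'.2.2.2.le⟩ h

theorem mem_levelRegion {x : ℝ × ℝ} (hx : x ∈ mixedRegion) : (x.1, U x) ∈ levelRegion U := by
  obtain ⟨h0, h1, h2, h3⟩ := hx
  have h := hU.strictMonoOn_slice x.1
  have htop := h2.le.trans h3.le
  exact ⟨⟨⟨h0, h1⟩, h (left_mem_Icc.2 htop) ⟨h2.le, h3.le⟩ h2⟩,
    ⟨h0, h1⟩, h ⟨h2.le, h3.le⟩ (right_mem_Icc.2 htop) h3⟩

theorem exists_mem_mixedRegion {e : ℝ × ℝ} (he : e ∈ levelRegion U) :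
    ∃ Y, (e.1, Y) ∈ mixedRegion ∧ U (e.1, Y) = e.2 := by
  have := hU.continuous
  obtain ⟨⟨hq, hbot⟩, -, htop⟩ := he
  obtain ⟨Y, hY, hUY⟩ := intermediate_value_Ioo (f := fun Y => U (e.1, Y))
    (mul_nonneg hq.1.le (sub_nonneg.2 hq.2.le)) (by fun_prop) ⟨hbot, htop⟩
  exact ⟨Y, ⟨hq.1, hq.2, hY.1, hY.2⟩, hUY⟩

variable {level : ℝ × ℝ → ℝ}
  (hlevel : ∀ e ∈ levelRegion U, (e.1, level e) ∈ mixedRegion ∧ U (e.1, level e) = e.2)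

include hlevel

theorem contDiffAt_level {e : ℝ × ℝ} (he : e ∈ levelRegion U) : ContDiffAt ℝ 2 level e := by
  obtain ⟨hx, hUx⟩ := hlevel e he
  let f : (ℝ × ℝ) × ℝ → ℝ := fun v => U (v.1.1, v.2) - v.1.2
  have hf : ContDiffAt ℝ 2 f (e, level e) :=
    ((hU.contDiffAt _ hx).comp (e, level e) (f := fun v : (ℝ × ℝ) × ℝ => (v.1.1, v.2))
      (by fun_prop)).sub (by fun_prop)
  have hinv : (fderiv ℝ f (e, level e) ∘L .inr ℝ (ℝ × ℝ) ℝ).IsInvertible := by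
    refine isInvertible_of_apply_one_ne_zero ?_
    have hslice : fderiv ℝ f (e, level e) (0, 1) = deriv (fun Y => U (e.1, Y)) (level e) :=
      (fderiv_apply_zero_one (hf.differentiableAt two_ne_zero)).trans (deriv_sub_const e.2)
    simpa [hslice] using (hU.deriv_pos _ hx).ne'
  have hψ := hf.contDiffAt_implicitFunction two_ne_zero hinv
  have hψe := hf.implicitFunction_apply_self two_ne_zero hinv
  have hψf := hf.eventually_apply_implicitFunction two_ne_zero hinv
  set ψ := hf.implicitFunction two_ne_zero hinv
  have hψmem : ∀ᶠ y in nhds e, (y.1, ψ y) ∈ mixedRegion :=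
    (continuousAt_fst.prodMk hψ.continuousAt).eventually_mem
      (isOpen_mixedRegion.mem_nhds (by simpa only [hψe] using hx))
  refine hψ.congr_of_eventuallyEq ?_
  filter_upwards [hψf, hψmem, hU.isOpen_levelRegion.mem_nhds he] with y hfy hy hyl
  refine hU.eq_of_mem_mixedRegion (hlevel y hyl).1 hy ?_
  have : U (y.1, ψ y) - y.2 = U (e.1, level e) - e.2 := hfy
  linarith [(hlevel y hyl).2]

theorem concaveOn_level (hV : ConcaveAlongLevels U V) :
    ConcaveOn ℝ (levelRegion U) fun e => V (e.1, level e) := by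
  refine concaveOn_of_comp_lineMap hU.convex_levelRegion fun e he e' he' => ?_
  set E : ℝ →ᵃ[ℝ] ℝ × ℝ := AffineMap.lineMap e e'
  have hEC : ContDiff ℝ 2 E := AffineMap.contDiff_lineMap e e'
  have hE : ∀ t ∈ Icc (0 : ℝ) 1, E t ∈ levelRegion U := fun t ht =>
    hU.convex_levelRegion.lineMap_mem he he' ht
  have hY : ∀ t ∈ Icc (0 : ℝ) 1, ContDiffAt ℝ 2 (fun s => level (E s)) t := fun t ht =>
    (hU.contDiffAt_level hlevel (hE t ht)).comp t hEC.contDiffAt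
  refine concaveOn_of_deriv_deriv_nonpos (convex_Icc 0 1) (fun t ht => ?_) fun t ht => ?_
  · exact (hV.contDiffAt _ (hlevel _ (hE t ht)).1).comp t (hEC.fst.contDiffAt.prodMk (hY t ht))
  have hE₁ : ∀ s, HasDerivAt (fun s => (E s).1) (e'.1 - e.1) s := fun s => by
    simpa only [E, AffineMap.fst_lineMap] using AffineMap.hasDerivAt_lineMap
  have hE₂ : ∀ s, HasDerivAt (fun s => (E s).2) (e'.2 - e.2) s := fun s => by
    simpa only [E, AffineMap.snd_lineMap] using AffineMap.hasDerivAt_lineMap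
  refine hV.deriv_deriv_nonpos _ _ _ t hE₁ (hY t ht) (hlevel _ (hE t ht)).1 ?_
  have hUE : (fun s => U ((E s).1, level (E s))) =ᶠ[nhds t] fun s => (E s).2 := by
    filter_upwards [hEC.continuous.continuousAt.eventually_mem
      (hU.isOpen_levelRegion.mem_nhds (hE t ht))] with s hs using (hlevel _ hs).2
  rw [hUE.deriv.deriv_eq, funext fun s => (hE₂ s).deriv, deriv_const]

end LevelFunction

section Jensen

variable {U V : ℝ × ℝ → ℝ} {ι : Type*} [Fintype ι] {p : ι → ℝ} {x : ι → ℝ × ℝ}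

theorem exists_jensen_of_mem_mixedRegion (hU : LevelFunction U) (hV : ConcaveAlongLevels U V)
    (hp : ∀ i, 0 ≤ p i) (hp1 : ∑ i, p i = 1) (hx : ∀ i, x i ∈ mixedRegion) :
    ∃ Y, (∑ i, p i * (x i).1, Y) ∈ mixedRegion ∧
      U (∑ i, p i * (x i).1, Y) = ∑ i, p i * U (x i) ∧
      ∑ i, p i * V (x i) ≤ V (∑ i, p i * (x i).1, Y) := by
  choose! level hlevel using fun e (he : e ∈ levelRegion U) => hU.exists_mem_mixedRegion he
  have hmem : ∀ i, ((x i).1, U (x i)) ∈ levelRegion U := fun i => hU.mem_levelRegion (hx i)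
  have hself : ∀ i, level ((x i).1, U (x i)) = (x i).2 := fun i =>
    hU.eq_of_mem_mixedRegion (hlevel _ (hmem i)).1 (hx i) (hlevel _ (hmem i)).2
  have hmean : ∑ i, p i • (((x i).1, U (x i)) : ℝ × ℝ)
      = (∑ i, p i * (x i).1, ∑ i, p i * U (x i)) := by
    ext <;> simp [Prod.fst_sum, Prod.snd_sum]
  have hJ := (hU.concaveOn_level hlevel hV).le_map_sum (t := Finset.univ) (fun i _ => hp i) hp1
    fun i _ => hmem i
  have hM := hU.convex_levelRegion.sum_mem (t := Finset.univ) (fun i _ => hp i) hp1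
    fun i _ => hmem i
  rw [hmean] at hJ hM
  exact ⟨_, (hlevel _ hM).1, (hlevel _ hM).2, by simpa only [hself, smul_eq_mul] using hJ⟩

theorem exists_jensen (hU : LevelFunction U) (hV : ConcaveAlongLevels U V)
    (hp : ∀ i, 0 ≤ p i) (hp1 : ∑ i, p i = 1) (hx : ∀ i, x i ∈ stateRegion) :
    ∃ Y, (∑ i, p i * (x i).1, Y) ∈ stateRegion ∧
      U (∑ i, p i * (x i).1, Y) = ∑ i, p i * U (x i) ∧
      ∑ i, p i * V (x i) ≤ V (∑ i, p i * (x i).1, Y) := by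
  let good : Set ((ι → ℝ × ℝ) × Icc (0 : ℝ) (1 / 4)) := {v |
    (∑ i, p i * (v.1 i).1, v.2.1) ∈ stateRegion ∧
      U (∑ i, p i * (v.1 i).1, v.2.1) = ∑ i, p i * U (v.1 i) ∧
      ∑ i, p i * V (v.1 i) ≤ V (∑ i, p i * (v.1 i).1, v.2.1)}
  have hgood : IsClosed good := by
    have := hU.continuous
    have := hV.continuous
    simp only [good, ofPred_and]
    refine (isClosed_stateRegion.preimage ?_).inter
      ((isClosed_eq ?_ ?_).inter (isClosed_le ?_ ?_)) <;> fun_prop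
  have hclosed : IsClosed (Prod.fst '' good) := isClosedMap_fst_of_compactSpace good hgood
  have hmixed : univ.pi (fun _ => mixedRegion) ⊆ Prod.fst '' good := fun y hy => by
    obtain ⟨Y, hY, h⟩ := exists_jensen_of_mem_mixedRegion hU hV hp hp1 fun i => hy i trivial
    have hY := mixedRegion_subset_stateRegion hY
    exact ⟨(y, ⟨Y, snd_mem_Icc_of_mem_stateRegion hY⟩), ⟨hY, h⟩, rfl⟩
  have hxc : x ∈ closure (univ.pi fun _ => mixedRegion) := by
    rw [closure_pi_set]
    exact fun i _ => stateRegion_subset_closure (hx i)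
  obtain ⟨⟨_, Y⟩, h, rfl⟩ := hclosed.closure_subset_iff.2 hmixed hxc
  exact ⟨Y, h⟩

end Jensen

/-! ### Output entropies of amplitude damping -/

section OutEntropy

variable {z w η q R t : ℝ} {x : ℝ × ℝ} {Q Y D : ℝ → ℝ}

/-- The determinant of the output of the amplitude damping channel of transmissivity `z` on a
qubit state with excited-state population `x.1` and determinant `x.2`. -/
def outDet (z : ℝ) (x : ℝ × ℝ) : ℝ := z * x.2 + z * (1 - z) * x.1 ^ 2

/-- The entropy, in nats, of the output of the amplitude damping channel of transmissivity `z` on a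
qubit state with excited-state population `x.1` and determinant `x.2`. -/
def outEntropy (z : ℝ) (x : ℝ × ℝ) : ℝ := detEntropy (outDet z x)

theorem outDet_one (x : ℝ × ℝ) : outDet 1 x = x.2 := by
  simp [outDet]

theorem outDet_one_sub (η : ℝ) (x : ℝ × ℝ) :
    outDet (1 - η) x = (1 - η) * x.2 + η * (1 - η) * x.1 ^ 2 := by
  rw [outDet]
  ring

theorem outDet_mem_Icc (hz : z ∈ Icc (0 : ℝ) 1) (hx : x ∈ stateRegion) :
    outDet z x ∈ Icc (0 : ℝ) (1 / 4) := by
  obtain ⟨-, -, h3, h4⟩ := hx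
  have := sub_nonneg.2 hz.2
  have := hz.1
  refine ⟨by rw [outDet]; positivity, ?_⟩
  rw [outDet]
  linarith [sq_nonneg (z * x.1 - 1 / 2), mul_le_mul_of_nonneg_left h4 hz.1]

theorem outDet_mem_Ioo (hz : z ∈ Ioc (0 : ℝ) 1) (hx : x ∈ mixedRegion) :
    outDet z x ∈ Ioo (0 : ℝ) (1 / 4) := by
  obtain ⟨-, -, h3, h4⟩ := hx
  have := sub_nonneg.2 hz.2
  have := hz.1
  refine ⟨by rw [outDet]; positivity, ?_⟩
  rw [outDet]
  linarith [sq_nonneg (z * x.1 - 1 / 2), mul_lt_mul_of_pos_left h4 hz.1]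

@[fun_prop]
theorem continuous_outEntropy (z : ℝ) : Continuous (outEntropy z) := by
  have := continuous_detEntropy
  unfold outEntropy outDet
  fun_prop

theorem contDiffAt_outEntropy (hz : z ∈ Ioc (0 : ℝ) 1) (hx : x ∈ mixedRegion) :
    ContDiffAt ℝ 2 (outEntropy z) x :=
  (contDiffAt_detEntropy (outDet_mem_Ioo hz hx)).comp x (by unfold outDet; fun_prop)

theorem hasDerivAt_outEntropy_snd (hz : z ∈ Ioc (0 : ℝ) 1) (hx : x ∈ mixedRegion) :
    HasDerivAt (fun Y => outEntropy z (x.1, Y)) (z * detSlope (outDet z x)) x.2 := by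
  have hdet : HasDerivAt (fun Y => outDet z (x.1, Y)) z x.2 := by
    simpa [outDet] using ((hasDerivAt_id' x.2).const_mul z).add_const (z * (1 - z) * x.1 ^ 2)
  exact ((hasDerivAt_detEntropy (outDet_mem_Ioo hz hx)).comp x.2 hdet).congr_deriv (mul_comm _ _)

theorem deriv_deriv_detEntropy_comp (hD : ContDiffAt ℝ 2 D t) (ht : D t ∈ Ioo (0 : ℝ) (1 / 4)) :
    deriv (deriv fun s => detEntropy (D s)) t =
      detEntropyAccel (D t) (deriv D t) (deriv (deriv D) t) := by
  have hvel : (deriv fun s => detEntropy (D s)) =ᶠ[nhds t] fun s => detSlope (D s) * deriv D s := by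
    filter_upwards [hD.continuousAt.eventually_mem (isOpen_Ioo.mem_nhds ht),
      hD.eventually (by norm_num)] with s hs hs'
    exact ((hasDerivAt_detEntropy hs).comp s (hs'.differentiableAt two_ne_zero).hasDerivAt).deriv
  have hslope := (hasDerivAt_detSlope ht).comp t (hD.differentiableAt two_ne_zero).hasDerivAt
  rw [hvel.deriv_eq]
  refine (hslope.mul (differentiableAt_deriv_of_contDiffAt hD).hasDerivAt).deriv.trans ?_
  simp only [Function.comp, detEntropyAccel]
  ring

theorem contDiff_of_hasDerivAt_const (hQ : ∀ s, HasDerivAt Q R s) {n : WithTop ℕ∞} :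
    ContDiff ℝ n Q := by
  have hsub : ∀ s, HasDerivAt (fun s => Q s - R * s) 0 s := fun s =>
    ((hQ s).fun_sub ((hasDerivAt_id' s).const_mul R)).congr_deriv (by ring)
  have hconst := is_const_of_deriv_eq_zero (fun s => (hsub s).differentiableAt)
    fun s => (hsub s).deriv
  have hQR : Q = fun s => R * s + Q 0 := funext fun s => by linear_combination hconst s 0
  rw [hQR]
  fun_prop

theorem deriv_deriv_outEntropy (hz : z ∈ Ioc (0 : ℝ) 1) (hQ : ∀ s, HasDerivAt Q R s)
    (hY : ContDiffAt ℝ 2 Y t) (hx : (Q t, Y t) ∈ mixedRegion) :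
    deriv (deriv fun s => outEntropy z (Q s, Y s)) t =
      detEntropyAccel (outDet z (Q t, Y t)) (z * deriv Y t + 2 * (z * (1 - z)) * Q t * R)
        (z * deriv (deriv Y) t + 2 * (z * (1 - z)) * R ^ 2) := by
  have hQC : ContDiffAt ℝ 2 Q t := (contDiff_of_hasDerivAt_const hQ).contDiffAt
  have hD : ContDiffAt ℝ 2 (fun s => outDet z (Q s, Y s)) t := by
    unfold outDet
    fun_prop
  have hvel : deriv (fun s => outDet z (Q s, Y s)) =ᶠ[nhds t]
      fun s => z * deriv Y s + 2 * (z * (1 - z)) * Q s * R := by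
    filter_upwards [hY.eventually (by norm_num)] with s hs
    refine (((hs.differentiableAt two_ne_zero).hasDerivAt.const_mul z).add
      (((hQ s).fun_pow 2).const_mul (z * (1 - z)))).deriv.trans ?_
    ring
  have haccel : deriv (deriv fun s => outDet z (Q s, Y s)) t =
      z * deriv (deriv Y) t + 2 * (z * (1 - z)) * R ^ 2 := by
    rw [hvel.deriv_eq]
    refine (((differentiableAt_deriv_of_contDiffAt hY).hasDerivAt.const_mul z).add
      (((hQ t).const_mul (2 * (z * (1 - z)))).mul_const R)).deriv.trans ?_
    ring
  have hcomp := deriv_deriv_detEntropy_comp hD (outDet_mem_Ioo hz hx)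
  rwa [hvel.self_of_nhds, haccel] at hcomp

theorem detEntropy_mul_one_sub (u : ℝ) : detEntropy (u * (1 - u)) = binEntropy u := by
  rw [detEntropy, show 1 - 4 * (u * (1 - u)) = (1 - 2 * u) ^ 2 by ring, sqrt_sq_eq_abs]
  rcases abs_cases (1 - 2 * u) with ⟨habs, -⟩ | ⟨habs, -⟩
  · rw [habs, show (1 + (1 - 2 * u)) / 2 = 1 - u by ring, binEntropy_one_sub]
  · rw [habs, show (1 + -(1 - 2 * u)) / 2 = u by ring]

theorem outEntropy_mul_one_sub (z q : ℝ) : outEntropy z (q, q * (1 - q)) = binEntropy (z * q) := by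
  rw [← detEntropy_mul_one_sub, outEntropy, outDet]
  ring_nf

theorem concaveOn_binEntropy_const_mul (hz : z ∈ Icc (0 : ℝ) 1) :
    ConcaveOn ℝ (Ioo 0 1) fun q => binEntropy (z * q) :=
  (strictConcave_binEntropy.concaveOn.comp_linearMap (LinearMap.mulLeft ℝ z)).subset
    (fun _ hq => ⟨mul_nonneg hz.1 hq.1.le, mul_le_one₀ hz.2 hq.1.le hq.2.le⟩) (convex_Ioo _ _)

theorem outDet_bot_mem_Ioo (hz : z ∈ Ioo (0 : ℝ) 1) (hq : q ∈ Ioo (0 : ℝ) 1) :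
    outDet z (q, 0) ∈ Ioo (0 : ℝ) (1 / 4) := by
  have hz0 := mul_pos hz.1 (sub_pos.2 hz.2)
  have := hq.1
  have hsq : q ^ 2 < 1 := pow_lt_one₀ hq.1.le hq.2 two_ne_zero
  simp only [outDet, mul_zero, zero_add]
  refine ⟨by positivity, ?_⟩
  calc z * (1 - z) * q ^ 2 < z * (1 - z) := mul_lt_of_lt_one_right hz0 hsq
    _ ≤ 1 / 4 := by linarith [sq_nonneg (z - 1 / 2)]

theorem convexOn_outEntropy_bot (hz : z ∈ Ioo (0 : ℝ) 1) :
    ConvexOn ℝ (Ioo 0 1) fun q => outEntropy z (q, 0) := by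
  have hm : 0 < z * (1 - z) := mul_pos hz.1 (sub_pos.2 hz.2)
  have hdet : ∀ q : ℝ, outDet z (q, 0) = z * (1 - z) * q ^ 2 := fun q => by simp [outDet]
  refine convexOn_of_hasDerivAt_monotoneOn (convex_Ioo _ _) isOpen_Ioo
    (F' := fun q => 2 * √(z * (1 - z)) * (√(outDet z (q, 0)) * detSlope (outDet z (q, 0))))
    (fun q hq => ?_) fun x hx y hy hxy => ?_
  · have hD : HasDerivAt (fun q => outDet z (q, 0)) (z * (1 - z) * (2 * q)) q := by
      simpa [hdet] using (hasDerivAt_pow 2 q).const_mul (z * (1 - z))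
    refine ((hasDerivAt_detEntropy (outDet_bot_mem_Ioo hz hq)).comp q hD).congr_deriv ?_
    rw [hdet, sqrt_mul hm.le, sqrt_sq hq.1.le]
    linear_combination (-2 * q * detSlope (z * (1 - z) * q ^ 2)) * mul_self_sqrt hm.le
  · have hle : outDet z (x, 0) ≤ outDet z (y, 0) := by
      have := hx.1
      rw [hdet, hdet]
      gcongr
    exact mul_le_mul_of_nonneg_left (sqrt_mul_detSlope_monotoneOn (outDet_bot_mem_Ioo hz hx)
      (outDet_bot_mem_Ioo hz hy) hle) (by positivity)

theorem hasDerivAt_binEntropy_const_mul (hz : z ∈ Ioc (0 : ℝ) 1) (hq : q ∈ Ioo (0 : ℝ) 1) :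
    HasDerivAt (fun q => binEntropy (z * q)) (z * (log (1 - z * q) - log (z * q))) q := by
  have hzq : z * q < 1 := mul_lt_one_of_nonneg_of_lt_one_right hz.2 hq.1.le hq.2
  refine ((hasDerivAt_binEntropy (mul_pos hz.1 hq.1).ne' hzq.ne).comp q
    ((hasDerivAt_id' q).const_mul z)).congr_deriv ?_
  ring

theorem hasDerivAt_deriv_binEntropy_const_mul (hz : z ∈ Ioc (0 : ℝ) 1) (hq : q ∈ Ioo (0 : ℝ) 1) :
    HasDerivAt (fun q => z * (log (1 - z * q) - log (z * q))) (-(z / (q * (1 - z * q)))) q := by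
  have hzq : 1 - z * q ≠ 0 :=
    (sub_pos.2 (mul_lt_one_of_nonneg_of_lt_one_right hz.2 hq.1.le hq.2)).ne'
  have hz0 := hz.1.ne'
  have hq0 := hq.1.ne'
  have hid := (hasDerivAt_id' q).const_mul z
  refine (((hid.const_sub 1).log hzq).fun_sub (hid.log (mul_ne_zero hz0 hq0))).const_mul z
    |>.congr_deriv ?_
  field_simp
  ring

theorem concaveOn_binEntropy_sub (hη : 0 < η) (hz : η ≤ z) (hz1 : z ≤ 1) :
    ConcaveOn ℝ (Ioo 0 1) fun q => binEntropy (z * q) - binEntropy (η * q) := by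
  have hzI : z ∈ Ioc (0 : ℝ) 1 := ⟨hη.trans_le hz, hz1⟩
  have hηI : η ∈ Ioc (0 : ℝ) 1 := ⟨hη, hz.trans hz1⟩
  refine concaveOn_of_hasDerivAt_antitoneOn (convex_Ioo _ _) isOpen_Ioo (fun q hq =>
    (hasDerivAt_binEntropy_const_mul hzI hq).sub (hasDerivAt_binEntropy_const_mul hηI hq)) ?_
  refine antitoneOn_of_hasDerivAt_nonpos (convex_Ioo _ _) (fun q hq =>
    (hasDerivAt_deriv_binEntropy_const_mul hzI hq).fun_sub
      (hasDerivAt_deriv_binEntropy_const_mul hηI hq)) fun q hq => ?_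
  have hzq : 0 < 1 - z * q := sub_pos.2 (mul_lt_one_of_nonneg_of_lt_one_right hz1 hq.1.le hq.2)
  have : η / (q * (1 - η * q)) ≤ z / (q * (1 - z * q)) := by
    have := hq.1
    have := hzI.1
    gcongr
  linarith

end OutEntropy

/-! ### Matching entropies -/

section Matching

variable {z w η : ℝ}

theorem levelFunction_outEntropy (hz : z ∈ Ioo (0 : ℝ) 1) : LevelFunction (outEntropy z) where
  continuous := continuous_outEntropy z
  contDiffAt _ := contDiffAt_outEntropy ⟨hz.1, hz.2.le⟩
  deriv_pos x hx := by
    have hz' : z ∈ Ioc (0 : ℝ) 1 := ⟨hz.1, hz.2.le⟩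
    rw [(hasDerivAt_outEntropy_snd hz' hx).deriv]
    exact mul_pos hz.1 (detSlope_pos (outDet_mem_Ioo hz' hx))
  convexOn_bot := convexOn_outEntropy_bot hz
  concaveOn_top := by
    simp only [outEntropy_mul_one_sub]
    exact concaveOn_binEntropy_const_mul ⟨hz.1.le, hz.2.le⟩

theorem levelFunction_outEntropy_sub (hη : 0 < η) (hη2 : η < 1 / 2) :
    LevelFunction fun x => outEntropy (1 - η) x - outEntropy η x := by
  have hηI : η ∈ Ioc (0 : ℝ) 1 := ⟨hη, by linarith⟩
  have hzI : 1 - η ∈ Ioc (0 : ℝ) 1 := ⟨by linarith, by linarith⟩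
  refine ⟨by fun_prop, fun x hx =>
    (contDiffAt_outEntropy hzI hx).sub (contDiffAt_outEntropy hηI hx), fun x hx => ?_, ?_, ?_⟩
  · have := hx.1
    have hX := outDet_mem_Ioo hzI hx
    rw [((hasDerivAt_outEntropy_snd hzI hx).fun_sub (hasDerivAt_outEntropy_snd hηI hx)).deriv,
      sub_pos]
    rw [outDet_one_sub] at hX ⊢
    exact mul_detSlope_lt_mul hη (by linarith) (mul_pos (mul_pos hη hzI.1) (pow_pos hx.1 2)) hX
      (outDet_mem_Ioo hηI hx)
  · have hzero : ∀ q : ℝ, outEntropy (1 - η) (q, 0) - outEntropy η (q, 0) = 0 := fun q => by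
      rw [outEntropy, outEntropy, outDet_one_sub, outDet, mul_zero, mul_zero, sub_self]
    simp only [hzero]
    exact convexOn_const 0 (convex_Ioo _ _)
  · simp only [outEntropy_mul_one_sub]
    exact concaveOn_binEntropy_sub hη (by linarith) hzI.2

theorem concaveAlongLevels_outEntropy (hz : 0 < z) (hzw : z < w) (hw : w ≤ 1) :
    ConcaveAlongLevels (outEntropy z) (outEntropy w) := by
  have hw0 := hz.trans hzw
  have hwI : w ∈ Ioc (0 : ℝ) 1 := ⟨hw0, hw⟩
  have hzI : z ∈ Ioc (0 : ℝ) 1 := ⟨hz, hzw.le.trans hw⟩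
  refine ⟨by fun_prop, fun x hx => contDiffAt_outEntropy hwI hx, fun Q Y R t hQ hY hm h => ?_⟩
  have hX := outDet_mem_Ioo hzI hm
  have hV := outDet_mem_Ioo hwI hm
  rw [deriv_deriv_outEntropy hzI hQ hY hm, detEntropyAccel] at h
  rw [deriv_deriv_outEntropy hwI hQ hY hm, detEntropyAccel]
  refine mul_nonpos_of_nonneg_of_nonpos (detSlope_pos hV).le ?_
  have hq : 0 < Q t := hm.1
  have hzero := (mul_eq_zero.1 h).resolve_left (detSlope_pos hX).ne'
  have hgap : outDet z (Q t, Y t) - z / w * outDet w (Q t, Y t) = z * (w - z) * Q t ^ 2 := by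
    simp only [outDet]
    field_simp
    ring
  have : 0 < z * (w - z) := mul_pos hz (sub_pos.2 hzw)
  have key := sq_div_detDefect_le (c := z / w) (P := w * deriv Y t + 2 * (w * (1 - w)) * Q t * R)
    (K := 2 * (z * (w - z)) * Q t * R) ⟨by positivity, (div_le_one hw0).2 hzw.le⟩ hV hX
    (sub_pos.1 (hgap ▸ by positivity))
  have hvel : z / w * (w * deriv Y t + 2 * (w * (1 - w)) * Q t * R) + 2 * (z * (w - z)) * Q t * R =
      z * deriv Y t + 2 * (z * (1 - z)) * Q t * R := by
    field_simp
    ring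
  have hacc : z / w * (w * deriv (deriv Y) t + 2 * (w * (1 - w)) * R ^ 2) =
      z * deriv (deriv Y) t + 2 * (z * (1 - w)) * R ^ 2 := by
    field_simp
  have hK : (2 * (z * (w - z)) * Q t * R) ^ 2 / (2 * (z * (w - z) * Q t ^ 2)) =
      2 * (z * (w - z)) * R ^ 2 := by
    field_simp
  rw [hgap, hvel, hK] at key
  refine nonpos_of_mul_nonpos_right ?_ (div_pos hz hw0)
  rw [mul_sub, hacc]
  linear_combination hzero + key

theorem deriv_deriv_sub {f g : ℝ → ℝ} {t : ℝ} (hf : ContDiffAt ℝ 2 f t) (hg : ContDiffAt ℝ 2 g t) :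
    deriv (deriv fun s => f s - g s) t = deriv (deriv f) t - deriv (deriv g) t := by
  have hderiv : (deriv fun s => f s - g s) =ᶠ[nhds t] fun s => deriv f s - deriv g s := by
    filter_upwards [hf.eventually (by norm_num), hg.eventually (by norm_num)] with s hfs hgs
    exact deriv_fun_sub (hfs.differentiableAt two_ne_zero) (hgs.differentiableAt two_ne_zero)
  rw [hderiv.deriv_eq]
  exact deriv_fun_sub (differentiableAt_deriv_of_contDiffAt hf)
    (differentiableAt_deriv_of_contDiffAt hg)

theorem deriv_deriv_outEntropy_sub {R t : ℝ} {Q Y : ℝ → ℝ} (hz : z ∈ Ioc (0 : ℝ) 1)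
    (hw : w ∈ Ioc (0 : ℝ) 1) (hQ : ∀ s, HasDerivAt Q R s) (hY : ContDiffAt ℝ 2 Y t)
    (hx : (Q t, Y t) ∈ mixedRegion) :
    deriv (deriv fun s => outEntropy z (Q s, Y s) - outEntropy w (Q s, Y s)) t =
      deriv (deriv fun s => outEntropy z (Q s, Y s)) t
        - deriv (deriv fun s => outEntropy w (Q s, Y s)) t := by
  have hcurve : ContDiffAt ℝ 2 (fun s => (Q s, Y s)) t :=
    (contDiff_of_hasDerivAt_const hQ).contDiffAt.prodMk hY
  exact deriv_deriv_sub (.comp (g := outEntropy z) t (contDiffAt_outEntropy hz hx) hcurve)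
    (.comp (g := outEntropy w) t (contDiffAt_outEntropy hw hx) hcurve)

theorem concaveAlongLevels_outEntropy_sub (hη : 0 < η) (hη2 : η < 1 / 2) :
    ConcaveAlongLevels (fun x => outEntropy (1 - η) x - outEntropy η x)
      fun x => outEntropy 1 x - outEntropy (1 - η) x := by
  have hηI : η ∈ Ioc (0 : ℝ) 1 := ⟨hη, by linarith⟩
  have hzI : 1 - η ∈ Ioc (0 : ℝ) 1 := ⟨by linarith, by linarith⟩
  have h1I : (1 : ℝ) ∈ Ioc (0 : ℝ) 1 := ⟨one_pos, le_rfl⟩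
  refine ⟨by fun_prop, fun x hx => (contDiffAt_outEntropy h1I hx).sub
    (contDiffAt_outEntropy hzI hx), fun Q Y R t hQ hY hm h => ?_⟩
  rw [deriv_deriv_outEntropy_sub hzI hηI hQ hY hm, sub_eq_zero] at h
  rw [deriv_deriv_outEntropy_sub h1I hzI hQ hY hm, sub_nonpos]
  rw [deriv_deriv_outEntropy hzI hQ hY hm] at h ⊢
  rw [deriv_deriv_outEntropy hηI hQ hY hm] at h
  rw [deriv_deriv_outEntropy h1I hQ hY hm]
  have hY' := outDet_mem_Ioo h1I hm
  have hX := outDet_mem_Ioo hzI hm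
  have hZ := outDet_mem_Ioo hηI hm
  have hq : 0 < Q t := hm.1
  have hk : 0 < η * (1 - η) := mul_pos hη hzI.1
  have hK : 2 * (η * (1 - η)) * R ^ 2 =
      (2 * (η * (1 - η)) * Q t * R) ^ 2 / (2 * (η * (1 - η) * Q t ^ 2)) := by
    field_simp
  simp only [outDet_one_sub, outDet_one] at h hX hY' ⊢
  rw [outDet] at h hZ
  simp only [sub_sub_cancel, mul_comm (1 - η) η, hK] at h ⊢
  simpa using detEntropyAccel_le_of_eq hη (by linarith) (by ring) (by positivity) hY' hX hZ h

end Matching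

section Dominates

variable {ι : Type*} [Fintype ι] {η Y : ℝ} {p : ι → ℝ} {x : ι → ℝ × ℝ}

/-- The state with the mean population of the mixture `(p, x)` and determinant `Y` is at least as
good as the mixture for each of the three rates of the channel of transmissivity `η`. -/
structure Dominates (η : ℝ) (p : ι → ℝ) (x : ι → ℝ × ℝ) (Y : ℝ) : Prop where
  mem : (∑ i, p i * (x i).1, Y) ∈ stateRegion
  mutual_le : ∑ i, p i * (outEntropy 1 (x i) - outEntropy (1 - η) (x i)) ≤
    outEntropy 1 (∑ i, p i * (x i).1, Y) - outEntropy (1 - η) (∑ i, p i * (x i).1, Y)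
  coherent_le : ∑ i, p i * (outEntropy η (x i) - outEntropy (1 - η) (x i)) ≤
    outEntropy η (∑ i, p i * (x i).1, Y) - outEntropy (1 - η) (∑ i, p i * (x i).1, Y)
  environment_le : outEntropy (1 - η) (∑ i, p i * (x i).1, Y) ≤
    ∑ i, p i * outEntropy (1 - η) (x i)

theorem detEntropy_zero : detEntropy 0 = 0 := by
  simp [detEntropy]

theorem outEntropy_zero (x : ℝ × ℝ) : outEntropy 0 x = 0 := by
  simp [outEntropy, outDet, detEntropy_zero]

theorem outEntropy_one (x : ℝ × ℝ) : outEntropy 1 x = detEntropy x.2 := by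
  rw [outEntropy, outDet_one]

theorem outEntropy_one_nonneg {x : ℝ × ℝ} (hx : x ∈ stateRegion) : 0 ≤ outEntropy 1 x := by
  rw [outEntropy_one, ← detEntropy_zero]
  have hY := snd_mem_Icc_of_mem_stateRegion hx
  exact detEntropy_strictMonoOn.monotoneOn ⟨le_rfl, by norm_num⟩ hY hY.1

theorem outEntropy_le_binEntropy {z : ℝ} {x : ℝ × ℝ} (hz : z ∈ Icc (0 : ℝ) 1)
    (hx : x ∈ stateRegion) : outEntropy z x ≤ binEntropy (z * x.1) := by
  have hdiag : (x.1, x.1 * (1 - x.1)) ∈ stateRegion :=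
    ⟨hx.1, hx.2.1, hx.2.2.1.trans hx.2.2.2, le_rfl⟩
  rw [← outEntropy_mul_one_sub]
  refine detEntropy_strictMonoOn.monotoneOn (outDet_mem_Icc hz hx) (outDet_mem_Icc hz hdiag) ?_
  exact add_le_add_left (mul_le_mul_of_nonneg_left hx.2.2.2 hz.1) _

theorem sum_mul_fst_mem_Icc (hp : ∀ i, 0 ≤ p i) (hp1 : ∑ i, p i = 1)
    (hx : ∀ i, x i ∈ stateRegion) : ∑ i, p i * (x i).1 ∈ Icc (0 : ℝ) 1 :=
  (convex_Icc 0 1).sum_mem (fun i _ => hp i) hp1 fun i _ => ⟨(hx i).1, (hx i).2.1⟩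

theorem dominates_zero (hp : ∀ i, 0 ≤ p i) (hp1 : ∑ i, p i = 1) (hx : ∀ i, x i ∈ stateRegion) :
    Dominates 0 p x 0 := by
  have hq := sum_mul_fst_mem_Icc hp hp1 hx
  have hnonneg : 0 ≤ ∑ i, p i * outEntropy 1 (x i) :=
    Finset.sum_nonneg fun i _ => mul_nonneg (hp i) (outEntropy_one_nonneg (hx i))
  have hpure : outEntropy 1 (∑ i, p i * (x i).1, 0) = 0 := by
    rw [outEntropy_one, detEntropy_zero]
  refine ⟨⟨hq.1, hq.2, le_rfl, mul_nonneg hq.1 (sub_nonneg.2 hq.2)⟩, ?_, ?_, ?_⟩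
  · simp
  · simpa [outEntropy_zero, hpure] using hnonneg
  · simpa [hpure] using hnonneg

theorem dominates_one (hp : ∀ i, 0 ≤ p i) (hp1 : ∑ i, p i = 1) (hx : ∀ i, x i ∈ stateRegion) :
    Dominates 1 p x ((∑ i, p i * (x i).1) * (1 - ∑ i, p i * (x i).1)) := by
  have hq := sum_mul_fst_mem_Icc hp hp1 hx
  have hconcave : ∑ i, p i * outEntropy 1 (x i) ≤ binEntropy (∑ i, p i * (x i).1) :=
    calc ∑ i, p i * outEntropy 1 (x i) ≤ ∑ i, p i * binEntropy (x i).1 :=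
          Finset.sum_le_sum fun i _ => mul_le_mul_of_nonneg_left
            (by simpa using outEntropy_le_binEntropy (z := 1) (by simp) (hx i)) (hp i)
      _ ≤ binEntropy (∑ i, p i * (x i).1) :=
          strictConcave_binEntropy.concaveOn.le_map_sum (fun i _ => hp i) hp1
            fun i _ => ⟨(hx i).1, (hx i).2.1⟩
  refine ⟨⟨hq.1, hq.2, mul_nonneg hq.1 (sub_nonneg.2 hq.2), le_rfl⟩, ?_, ?_, ?_⟩
  · simpa [outEntropy_zero, outEntropy_mul_one_sub] using hconcave
  · simpa [outEntropy_zero, outEntropy_mul_one_sub] using hconcave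
  · simp [outEntropy_zero]

theorem exists_dominates_of_lt_half (hη : 0 < η) (hη2 : η < 1 / 2) (hp : ∀ i, 0 ≤ p i)
    (hp1 : ∑ i, p i = 1) (hx : ∀ i, x i ∈ stateRegion) : ∃ Y, Dominates η p x Y := by
  have hlevel := levelFunction_outEntropy (z := 1 - η) ⟨by linarith, by linarith⟩
  have hlevel' := levelFunction_outEntropy (z := η) ⟨hη, by linarith⟩
  have hsub := levelFunction_outEntropy_sub hη hη2
  obtain ⟨Y, hY, hYe, -⟩ := exists_jensen hlevel
    (concaveAlongLevels_outEntropy (w := 1) (by linarith) (by linarith) le_rfl) hp hp1 hx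
  obtain ⟨Y', hY', hYo', hYe'⟩ := exists_jensen hlevel'
    (concaveAlongLevels_outEntropy (w := 1 - η) hη (by linarith) (by linarith)) hp hp1 hx
  obtain ⟨Y₀, hY₀, hYc₀, hYm₀⟩ := exists_jensen hsub
    (concaveAlongLevels_outEntropy_sub hη hη2) hp hp1 hx
  have hYY' : Y ≤ Y' := ((hlevel.strictMonoOn_slice _).le_iff_le hY.2.2 hY'.2.2).1
    (hYe.trans_le hYe')
  have hout := ((hlevel'.strictMonoOn_slice _).le_iff_le hY.2.2 hY'.2.2).2 hYY'
  simp only [mul_sub, Finset.sum_sub_distrib] at hYc₀ hYm₀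
  have hY₀Y : Y₀ ≤ Y := ((hsub.strictMonoOn_slice _).le_iff_le hY₀.2.2 hY.2.2).1
    (by linarith)
  have henv := ((hlevel.strictMonoOn_slice _).le_iff_le hY₀.2.2 hY.2.2).2 hY₀Y
  refine ⟨Y₀, hY₀, ?_, ?_, henv.trans_eq hYe⟩ <;>
    · simp only [mul_sub, Finset.sum_sub_distrib]
      linarith

theorem exists_dominates_of_half_le (hη : 1 / 2 ≤ η) (hη1 : η < 1) (hp : ∀ i, 0 ≤ p i)
    (hp1 : ∑ i, p i = 1) (hx : ∀ i, x i ∈ stateRegion) : ∃ Y, Dominates η p x Y := by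
  have hlevel := levelFunction_outEntropy (z := 1 - η) ⟨by linarith, by linarith⟩
  obtain ⟨Y, hY, hYe, hYm⟩ := exists_jensen hlevel
    (concaveAlongLevels_outEntropy (w := 1) (by linarith) (by linarith) le_rfl) hp hp1 hx
  refine ⟨Y, hY, ?_, ?_, hYe.le⟩ <;> simp only [mul_sub, Finset.sum_sub_distrib]
  · linarith
  rcases hη.eq_or_lt with rfl | hη
  · norm_num
  obtain ⟨Y', hY', hYe', hYo'⟩ := exists_jensen hlevel
    (concaveAlongLevels_outEntropy (w := η) (by linarith) (by linarith) hη1.le) hp hp1 hx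
  obtain rfl : Y' = Y := (hlevel.strictMonoOn_slice _).injOn hY'.2.2 hY.2.2 (hYe'.trans hYe.symm)
  linarith

theorem exists_dominates (hη : η ∈ Icc (0 : ℝ) 1) (hp : ∀ i, 0 ≤ p i) (hp1 : ∑ i, p i = 1)
    (hx : ∀ i, x i ∈ stateRegion) : ∃ Y, Dominates η p x Y := by
  rcases hη.1.eq_or_lt with rfl | hη0
  · exact ⟨_, dominates_zero hp hp1 hx⟩
  rcases hη.2.eq_or_lt with rfl | hη1
  · exact ⟨_, dominates_one hp hp1 hx⟩
  rcases lt_or_ge η (1 / 2) with hη2 | hη2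
  · exact exists_dominates_of_lt_half hη0 hη2 hp hp1 hx
  · exact exists_dominates_of_half_le hη2 hη1 hp hp1 hx

end Dominates

/-! ### Von Neumann entropies from characteristic polynomials -/

section Spectral

open Polynomial

variable {ι m n : Type*} [Fintype ι] [DecidableEq ι] [Fintype m] [DecidableEq m] [Fintype n]
  [DecidableEq n]

/-- The sum of `-t log t` over the real parts `t` of the roots of a polynomial. At the
characteristic polynomial of a Hermitian matrix it is the von Neumann entropy in nats. -/
def rootEntropy (P : ℂ[X]) : ℝ := (P.roots.map fun t => negMulLog t.re).sum

theorem rootEntropy_mul {P Q : ℂ[X]} (hP : P ≠ 0) (hQ : Q ≠ 0) :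
    rootEntropy (P * Q) = rootEntropy P + rootEntropy Q := by
  simp [rootEntropy, roots_mul (mul_ne_zero hP hQ)]

theorem rootEntropy_prod {κ : Type*} [Fintype κ] {P : κ → ℂ[X]} (hP : ∀ i, P i ≠ 0) :
    rootEntropy (∏ i, P i) = ∑ i, rootEntropy (P i) := by
  simp [rootEntropy, roots_prod P Finset.univ (Finset.prod_ne_zero_iff.2 fun i _ => hP i),
    Multiset.map_bind, Multiset.sum_bind]

theorem rootEntropy_X_pow_mul (k : ℕ) {P : ℂ[X]} (hP : P ≠ 0) :
    rootEntropy (X ^ k * P) = rootEntropy P := by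
  rw [rootEntropy_mul (pow_ne_zero k X_ne_zero) hP]
  simp [rootEntropy, Multiset.map_nsmul, Multiset.sum_nsmul]

theorem rootEntropy_X_sub_C (t : ℂ) : rootEntropy (X - C t) = negMulLog t.re := by
  simp [rootEntropy]

theorem vnEntropy_eq_rootEntropy {ρ : Matrix n n ℂ} (hρ : ρ.IsHermitian) :
    vnEntropy ρ = rootEntropy ρ.charpoly / log 2 := by
  rw [vnEntropy, dif_pos hρ, rootEntropy, hρ.roots_charpoly_eq_eigenvalues, Multiset.map_map,
    Finset.sum_map_val, Finset.sum_div]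
  refine Finset.sum_congr rfl fun i _ => ?_
  simp only [Function.comp, RCLike.ofReal_eq_complex_ofReal, Complex.ofReal_re, negMulLog, logb]
  ring

theorem vnEntropy_transpose (ρ : Matrix n n ℂ) : vnEntropy ρᵀ = vnEntropy ρ := by
  by_cases hρ : ρ.IsHermitian
  · rw [vnEntropy_eq_rootEntropy hρ, vnEntropy_eq_rootEntropy hρ.transpose,
      Matrix.charpoly_transpose]
  · rw [vnEntropy, vnEntropy, dif_neg hρ, dif_neg (mt Matrix.isHermitian_transpose_iff.1 hρ)]

theorem vnEntropy_mul_comm {M : Matrix m n ℂ} {N : Matrix n m ℂ} (hMN : (M * N).IsHermitian)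
    (hNM : (N * M).IsHermitian) : vnEntropy (M * N) = vnEntropy (N * M) := by
  have h := congrArg rootEntropy (Matrix.charpoly_mul_comm' M N)
  rw [rootEntropy_X_pow_mul _ (Matrix.charpoly_monic _).ne_zero,
    rootEntropy_X_pow_mul _ (Matrix.charpoly_monic _).ne_zero] at h
  rw [vnEntropy_eq_rootEntropy hMN, vnEntropy_eq_rootEntropy hNM, h]

theorem isHermitian_ofReal_smul {k : Type*} {ρ : Matrix k k ℂ} (hρ : ρ.IsHermitian) (p : ℝ) :
    ((p : ℂ) • ρ).IsHermitian :=
  hρ.smul (Complex.conj_ofReal p)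

theorem vnEntropy_smul_mul_conjTranspose (p : ℝ) (M : Matrix m n ℂ) :
    vnEntropy ((p : ℂ) • (M * Mᴴ)) = vnEntropy ((p : ℂ) • (Mᴴ * M)) := by
  have h := isHermitian_ofReal_smul (Matrix.isHermitian_mul_conjTranspose_self M) p
  have h' := isHermitian_ofReal_smul (Matrix.isHermitian_conjTranspose_mul_self M) p
  rw [← Matrix.smul_mul] at h ⊢
  rw [← Matrix.mul_smul] at h' ⊢
  exact vnEntropy_mul_comm h h'

/-- The block diagonal matrix with blocks `N x`, as `Matrix.blockDiagonal` but with the block index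
first. -/
def leftBlockDiagonal {ι k : Type*} [DecidableEq ι] (N : ι → Matrix k k ℂ) :
    Matrix (ι × k) (ι × k) ℂ :=
  Matrix.reindex (Equiv.prodComm k ι) (Equiv.prodComm k ι) (Matrix.blockDiagonal N)

theorem leftBlockDiagonal_apply {ι k : Type*} [DecidableEq ι] (N : ι → Matrix k k ℂ)
    (i j : ι × k) : leftBlockDiagonal N i j = if i.1 = j.1 then N i.1 i.2 j.2 else 0 := by
  simp [leftBlockDiagonal, Matrix.blockDiagonal_apply]

theorem charmatrix_blockDiagonal (N : ι → Matrix n n ℂ) :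
    (Matrix.blockDiagonal N).charmatrix = Matrix.blockDiagonal fun x => (N x).charmatrix := by
  ext ⟨i, x⟩ ⟨j, y⟩
  by_cases hxy : x = y
  · subst hxy
    by_cases hij : i = j
    · subst hij
      simp [Matrix.charmatrix_apply_eq, Matrix.blockDiagonal_apply]
    · simp [Matrix.blockDiagonal_apply, hij]
  · simp [Matrix.blockDiagonal_apply, hxy]

theorem charpoly_leftBlockDiagonal (N : ι → Matrix n n ℂ) :
    (leftBlockDiagonal N).charpoly = ∏ x, (N x).charpoly := by
  rw [leftBlockDiagonal, Matrix.charpoly_reindex, Matrix.charpoly, charmatrix_blockDiagonal,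
    Matrix.det_blockDiagonal]
  rfl

theorem vnEntropy_leftBlockDiagonal {N : ι → Matrix n n ℂ} (hN : ∀ x, (N x).IsHermitian) :
    vnEntropy (leftBlockDiagonal N) = ∑ x, vnEntropy (N x) := by
  have h : (leftBlockDiagonal N).IsHermitian :=
    (Matrix.isHermitian_reindex_iff _).2 (Matrix.isHermitian_blockDiagonal_iff.2 hN)
  rw [vnEntropy_eq_rootEntropy h, charpoly_leftBlockDiagonal,
    rootEntropy_prod fun x => (Matrix.charpoly_monic _).ne_zero, Finset.sum_div]
  exact Finset.sum_congr rfl fun x _ => (vnEntropy_eq_rootEntropy (hN x)).symm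

theorem vnEntropy_diagonal (p : n → ℝ) :
    vnEntropy (Matrix.diagonal fun i => (p i : ℂ)) = (∑ i, negMulLog (p i)) / log 2 := by
  rw [vnEntropy_eq_rootEntropy, Matrix.charpoly_diagonal,
    rootEntropy_prod fun x => X_sub_C_ne_zero _]
  · simp [rootEntropy_X_sub_C]
  · exact Matrix.isHermitian_diagonal_of_self_adjoint _ (by ext i; simp)

end Spectral

section Qubit

open Polynomial

variable {ρ : Matrix (Fin 2) (Fin 2) ℂ} {a b : ℝ}

theorem vnEntropy_fin_two (hρ : ρ.IsHermitian) (htr : ρ.trace = a + b) (hdet : ρ.det = a * b) :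
    vnEntropy ρ = (negMulLog a + negMulLog b) / log 2 := by
  have hP : ρ.charpoly = (X - C (a : ℂ)) * (X - C (b : ℂ)) := by
    rw [Matrix.charpoly_fin_two, htr, hdet]
    simp only [map_add, map_mul]
    ring
  rw [vnEntropy_eq_rootEntropy hρ, hP, rootEntropy_mul (X_sub_C_ne_zero _) (X_sub_C_ne_zero _),
    rootEntropy_X_sub_C, rootEntropy_X_sub_C, Complex.ofReal_re, Complex.ofReal_re]

theorem ofReal_det_re {n : Type*} [Fintype n] [DecidableEq n] {ρ : Matrix n n ℂ}
    (hρ : ρ.IsHermitian) : (ρ.det.re : ℂ) = ρ.det := by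
  rw [← Complex.conj_eq_iff_re, starRingEnd_apply, ← Matrix.det_conjTranspose, hρ.eq]

theorem det_re_eq (hρ : ρ.IsHermitian) :
    ρ.det.re = (ρ 0 0).re * (ρ 1 1).re - Complex.normSq (ρ 0 1) := by
  rw [Matrix.det_fin_two, ← hρ.apply 1 0, Complex.star_def, Complex.mul_conj,
    ← show ((ρ 0 0).re : ℂ) = ρ 0 0 from hρ.coe_re_apply_self 0]
  simp

theorem four_mul_det_re_le_sq_trace_re (hρ : ρ.IsHermitian) :
    4 * ρ.det.re ≤ ρ.trace.re ^ 2 := by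
  rw [det_re_eq hρ, Matrix.trace_fin_two, Complex.add_re]
  linarith [Complex.normSq_nonneg (ρ 0 1), sq_nonneg ((ρ 0 0).re - (ρ 1 1).re)]

theorem vnEntropy_smul_of_trace_eq_one (hρ : ρ.IsHermitian) (htr : ρ.trace = 1) (p : ℝ) :
    vnEntropy ((p : ℂ) • ρ) = (negMulLog p + p * detEntropy ρ.det.re) / log 2 := by
  set u := (1 + √(1 - 4 * ρ.det.re)) / 2 with hu
  have hD : 0 ≤ 1 - 4 * ρ.det.re := by
    simpa [htr] using four_mul_det_re_le_sq_trace_re hρ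
  have hdet : ρ.det = u * (1 - u) := by
    rw [← ofReal_det_re hρ]
    norm_cast
    linear_combination (1 / 4) * mul_self_sqrt hD
  rw [vnEntropy_fin_two (a := p * u) (b := p * (1 - u)) (isHermitian_ofReal_smul hρ p),
    negMulLog_mul, negMulLog_mul, detEntropy, ← hu,
    binEntropy_eq_negMulLog_add_negMulLog_one_sub]
  · ring
  · rw [Matrix.trace_smul, htr]
    push_cast
    rw [smul_eq_mul]
    ring
  · rw [Matrix.det_smul, hdet, Fintype.card_fin]
    push_cast
    ring

end Qubit

/-! ### Entropies of the classical-quantum state of an ensemble -/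

section Kraus

variable {κ A A' B : Type*} [Fintype A']

/-- The pure state `φ` on `AA'` as a map from `A` to `A'`. -/
def stateMatrix (φ : A × A' → ℂ) : Matrix A' A ℂ := Matrix.of fun i a => φ (a, i)

/-- The reduced state on `A'` of the pure state `φ` on `AA'`. -/
def reducedState [Fintype A] (φ : A × A' → ℂ) : Matrix A' A' ℂ := stateMatrix φ * (stateMatrix φ)ᴴ

/-- The channel with Kraus operators `K`. -/
def krausMap [Fintype κ] (K : κ → Matrix B A' ℂ) (ρ : Matrix A' A' ℂ) : Matrix B B ℂ :=
  ∑ k, K k * ρ * (K k)ᴴ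

/-- The channel to the environment that is complementary to the channel with Kraus operators
`K`. -/
def complementaryMap [Fintype B] (K : κ → Matrix B A' ℂ) (ρ : Matrix A' A' ℂ) : Matrix κ κ ℂ :=
  Matrix.of fun k l => (K k * ρ * (K l)ᴴ).trace

/-- The pure state on `ABE` that arises from the pure state `φ` on `AA'` by the dilation
`∑ k, K k ⊗ |k⟩_E`, as a matrix from the environment `E` to `AB`. -/
def dilation (K : κ → Matrix B A' ℂ) (φ : A × A' → ℂ) : Matrix (A × B) κ ℂ :=
  Matrix.of fun i k => (K k * stateMatrix φ) i.2 i.1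

theorem isHermitian_reducedState {A' : Type*} [Fintype A] (φ : A × A' → ℂ) :
    (reducedState φ).IsHermitian :=
  Matrix.isHermitian_mul_conjTranspose_self _

theorem trace_reducedState [Fintype A] {φ : A × A' → ℂ} (hφ : ∑ i, ‖φ i‖ ^ 2 = 1) :
    (reducedState φ).trace = 1 := by
  have h : (reducedState φ).trace = ((∑ i, ‖φ i‖ ^ 2 : ℝ) : ℂ) := by
    rw [Fintype.sum_prod_type_right]
    simp [reducedState, stateMatrix, Matrix.trace, Matrix.mul_apply, Complex.mul_conj,
      Complex.normSq_eq_norm_sq]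
  rw [h, hφ, Complex.ofReal_one]

theorem isHermitian_krausMap [Fintype κ] (K : κ → Matrix B A' ℂ) {ρ : Matrix A' A' ℂ}
    (hρ : ρ.IsHermitian) : (krausMap K ρ).IsHermitian := by
  have h := fun k => (Matrix.isHermitian_mul_mul_conjTranspose (K k) hρ).eq
  simp only [Matrix.IsHermitian, krausMap, Matrix.conjTranspose_sum, h]

theorem isHermitian_complementaryMap [Fintype B] (K : κ → Matrix B A' ℂ) {ρ : Matrix A' A' ℂ}
    (hρ : ρ.IsHermitian) : (complementaryMap K ρ).IsHermitian := by
  refine Matrix.IsHermitian.ext fun k l => ?_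
  simp only [complementaryMap, Matrix.of_apply]
  rw [← Matrix.trace_conjTranspose, Matrix.conjTranspose_mul, Matrix.conjTranspose_mul,
    Matrix.conjTranspose_conjTranspose, hρ.eq, Matrix.mul_assoc]

theorem trace_krausMap [Fintype κ] [Fintype B] [DecidableEq A'] {K : κ → Matrix B A' ℂ}
    (hK : ∑ k, (K k)ᴴ * K k = 1) (ρ : Matrix A' A' ℂ) : (krausMap K ρ).trace = ρ.trace := by
  have h : ∀ k, (K k * ρ * (K k)ᴴ).trace = ((K k)ᴴ * K k * ρ).trace := fun k => by
    rw [Matrix.trace_mul_comm, Matrix.mul_assoc]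
  rw [krausMap, Matrix.trace_sum]
  simp only [h]
  rw [← Matrix.trace_sum, ← Finset.sum_mul, hK, one_mul]

theorem trace_complementaryMap [Fintype κ] [Fintype B] (K : κ → Matrix B A' ℂ)
    (ρ : Matrix A' A' ℂ) : (complementaryMap K ρ).trace = (krausMap K ρ).trace := by
  rw [krausMap, Matrix.trace_sum]
  rfl

theorem krausMap_sum_smul [Fintype κ] {X : Type*} [Fintype X] (K : κ → Matrix B A' ℂ) (p : X → ℂ)
    (ρ : X → Matrix A' A' ℂ) : krausMap K (∑ x, p x • ρ x) = ∑ x, p x • krausMap K (ρ x) := by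
  simp only [krausMap, Matrix.mul_sum, Matrix.sum_mul, Matrix.mul_smul, Matrix.smul_mul,
    Finset.smul_sum]
  exact Finset.sum_comm

theorem mul_reducedState_mul_conjTranspose {m n : Type*} [Fintype A] (M : Matrix m A' ℂ)
    (N : Matrix n A' ℂ) (φ : A × A' → ℂ) :
    M * reducedState φ * Nᴴ = M * stateMatrix φ * (N * stateMatrix φ)ᴴ := by
  simp only [reducedState, Matrix.conjTranspose_mul, Matrix.mul_assoc]

theorem conjTranspose_dilation_mul_dilation [Fintype A] [Fintype B] (K : κ → Matrix B A' ℂ)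
    (φ : A × A' → ℂ) :
    (dilation K φ)ᴴ * dilation K φ = (complementaryMap K (reducedState φ))ᵀ := by
  ext k l
  simp only [Matrix.transpose_apply, complementaryMap, Matrix.of_apply,
    mul_reducedState_mul_conjTranspose]
  simp [dilation, Matrix.mul_apply, Matrix.trace, Fintype.sum_prod_type_right, mul_comm]

theorem sum_dilation_reference [Fintype κ] [Fintype B] [DecidableEq A'] {K : κ → Matrix B A' ℂ}
    (hK : ∑ k, (K k)ᴴ * K k = 1) (φ : A × A' → ℂ) (a a' : A) :
    ∑ b, (dilation K φ * (dilation K φ)ᴴ) (a, b) (a', b) =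
      ((stateMatrix φ)ᴴ * stateMatrix φ) a' a := by
  have h : (stateMatrix φ)ᴴ * stateMatrix φ =
      ∑ k, (K k * stateMatrix φ)ᴴ * (K k * stateMatrix φ) := by
    have hk : ∀ k, (K k * stateMatrix φ)ᴴ * (K k * stateMatrix φ) =
        (stateMatrix φ)ᴴ * ((K k)ᴴ * K k) * stateMatrix φ := fun k => by
      simp only [Matrix.conjTranspose_mul, Matrix.mul_assoc]
    simp only [hk, ← Matrix.sum_mul, ← Matrix.mul_sum, hK, Matrix.mul_one]
  rw [h, Matrix.sum_apply]
  simp only [Matrix.mul_apply, Matrix.conjTranspose_apply, dilation, Matrix.of_apply, mul_comm]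
  rw [Finset.sum_comm]

theorem sum_dilation_output [Fintype κ] [Fintype A] (K : κ → Matrix B A' ℂ) (φ : A × A' → ℂ)
    (b b' : B) : ∑ a, (dilation K φ * (dilation K φ)ᴴ) (a, b) (a, b') =
      krausMap K (reducedState φ) b b' := by
  simp only [krausMap, mul_reducedState_mul_conjTranspose, Matrix.sum_apply, Matrix.mul_apply,
    Matrix.conjTranspose_apply, dilation, Matrix.of_apply]
  exact Finset.sum_comm

variable [Fintype κ] [Fintype A] [DecidableEq A]

theorem applyKraus_vecMulVec (K : κ → Matrix B A' ℂ) (φ : A × A' → ℂ) :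
    applyKraus K (Matrix.vecMulVec φ (star φ)) = dilation K φ * (dilation K φ)ᴴ := by
  have h : ∀ k, ((1 : Matrix A A ℂ) ⊗ₖ K k) *ᵥ φ = fun i => dilation K φ i k := fun k => by
    ext ⟨a, b⟩
    simp [dilation, stateMatrix, Matrix.mulVec, dotProduct, Fintype.sum_prod_type,
      Matrix.one_apply, Matrix.mul_apply]
  ext i j
  simp only [applyKraus, Matrix.mul_vecMulVec, Matrix.vecMulVec_mul, ← Matrix.star_mulVec, h,
    Matrix.sum_apply, Matrix.vecMulVec_apply, Matrix.mul_apply, Matrix.conjTranspose_apply,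
    Pi.star_apply]

end Kraus

section Ensemble

variable {κ X A A' B : Type*} [Fintype κ] [Fintype X] [DecidableEq X] [Fintype A] [DecidableEq A]
  [Fintype A'] {K : κ → Matrix B A' ℂ} {p : X → ℝ} {φ : X → A × A' → ℂ}

theorem cqState_eq_leftBlockDiagonal (K : κ → Matrix B A' ℂ) (p : X → ℝ) (φ : X → A × A' → ℂ) :
    cqState K p φ =
      leftBlockDiagonal fun x => (p x : ℂ) • (dilation K (φ x) * (dilation K (φ x))ᴴ) := by
  ext ⟨x, i⟩ ⟨y, j⟩
  simp only [cqState, applyKraus_vecMulVec, leftBlockDiagonal_apply, Matrix.sum_apply,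
    Matrix.smul_apply, Matrix.kroneckerMap_apply, Matrix.single_apply]
  rw [Finset.sum_eq_single x (fun z _ hz => by simp [hz]) (by simp)]
  by_cases h : x = y <;> simp [h]

theorem cqState_apply (x y : X) (a a' : A) (b b' : B) :
    cqState K p φ (x, a, b) (y, a', b') = if x = y then
      (p x : ℂ) * (dilation K (φ x) * (dilation K (φ x))ᴴ) (a, b) (a', b') else 0 := by
  simp [cqState_eq_leftBlockDiagonal, leftBlockDiagonal_apply]

theorem margXA_cqState [Fintype B] [DecidableEq A'] (hK : ∑ k, (K k)ᴴ * K k = 1) :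
    margXA (cqState K p φ) =
      (leftBlockDiagonal fun x => (p x : ℂ) • ((stateMatrix (φ x))ᴴ * stateMatrix (φ x)))ᵀ := by
  ext ⟨x, a⟩ ⟨y, a'⟩
  simp only [margXA, Matrix.of_apply, cqState_apply, Matrix.transpose_apply,
    leftBlockDiagonal_apply]
  by_cases h : x = y
  · subst h
    simp only [if_true, ← Finset.mul_sum, sum_dilation_reference hK, Matrix.smul_apply,
      smul_eq_mul]
  · simp [h, Ne.symm h]

theorem margXB_cqState : margXB (cqState K p φ) =
    leftBlockDiagonal fun x => (p x : ℂ) • krausMap K (reducedState (φ x)) := by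
  ext ⟨x, b⟩ ⟨y, b'⟩
  simp only [margXB, Matrix.of_apply, cqState_apply, leftBlockDiagonal_apply]
  by_cases h : x = y
  · simp only [if_pos h, ← Finset.mul_sum, sum_dilation_output, Matrix.smul_apply, smul_eq_mul]
  · simp [h]

theorem margX_cqState [Fintype B] [DecidableEq A'] (hK : ∑ k, (K k)ᴴ * K k = 1)
    (hφ : ∀ x, ∑ i, ‖φ x i‖ ^ 2 = 1) :
    margX (cqState K p φ) = Matrix.diagonal fun x => (p x : ℂ) := by
  ext x y
  simp only [margX, Matrix.of_apply, cqState_apply]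
  by_cases h : x = y
  · subst h
    have htr := (trace_krausMap hK _).trans (trace_reducedState (hφ x))
    rw [Finset.sum_comm]
    simp only [if_true, ← Finset.mul_sum, sum_dilation_output, Matrix.diagonal_apply_eq]
    exact (congrArg _ htr).trans (mul_one _)
  · simp [h]

theorem margB_cqState :
    margB (cqState K p φ) = krausMap K (∑ x, (p x : ℂ) • reducedState (φ x)) := by
  ext b b'
  simp only [margB, Matrix.of_apply, cqState_apply, if_true, ← Finset.mul_sum,
    sum_dilation_output, krausMap_sum_smul, Matrix.sum_apply, Matrix.smul_apply, smul_eq_mul]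

theorem vnEntropy_cqState [Fintype B] [DecidableEq B] [DecidableEq κ] : vnEntropy (cqState K p φ) =
    ∑ x, vnEntropy ((p x : ℂ) • complementaryMap K (reducedState (φ x))) := by
  rw [cqState_eq_leftBlockDiagonal, vnEntropy_leftBlockDiagonal fun x =>
    isHermitian_ofReal_smul (Matrix.isHermitian_mul_conjTranspose_self _) _]
  simp only [vnEntropy_smul_mul_conjTranspose, conjTranspose_dilation_mul_dilation,
    ← Matrix.transpose_smul, vnEntropy_transpose]

theorem vnEntropy_margXA_cqState [Fintype B] [DecidableEq A'] (hK : ∑ k, (K k)ᴴ * K k = 1) :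
    vnEntropy (margXA (cqState K p φ)) = ∑ x, vnEntropy ((p x : ℂ) • reducedState (φ x)) := by
  rw [margXA_cqState hK, vnEntropy_transpose, vnEntropy_leftBlockDiagonal fun x =>
    isHermitian_ofReal_smul (Matrix.isHermitian_conjTranspose_mul_self _) _]
  simp only [← vnEntropy_smul_mul_conjTranspose, reducedState]

theorem vnEntropy_margXB_cqState [Fintype B] [DecidableEq B] : vnEntropy (margXB (cqState K p φ)) =
    ∑ x, vnEntropy ((p x : ℂ) • krausMap K (reducedState (φ x))) := by
  rw [margXB_cqState, vnEntropy_leftBlockDiagonal fun x =>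
    isHermitian_ofReal_smul (isHermitian_krausMap K (isHermitian_reducedState (φ x))) _]

end Ensemble

/-! ### Rates of the amplitude damping channel -/

section AmplitudeDamping

variable {η : ℝ} {ρ : Matrix (Fin 2) (Fin 2) ℂ}

theorem ofReal_sqrt_mul_self {t : ℝ} (ht : 0 ≤ t) : ((√t : ℝ) : ℂ) * ((√t : ℝ) : ℂ) = t := by
  rw [← Complex.ofReal_mul, mul_self_sqrt ht]

theorem ofReal_sqrt_mul_mul_ofReal_sqrt {t : ℝ} (ht : 0 ≤ t) (w : ℂ) :
    ((√t : ℝ) : ℂ) * (w * ((√t : ℝ) : ℂ)) = w * t := by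
  rw [mul_left_comm, ofReal_sqrt_mul_self ht]

theorem sum_conjTranspose_mul_ampDampKraus (hη : η ∈ Icc (0 : ℝ) 1) :
    ∑ k, (ampDampKraus η k)ᴴ * ampDampKraus η k = 1 := by
  have hs := ofReal_sqrt_mul_self hη.1
  have hs' := ofReal_sqrt_mul_self (sub_nonneg.2 hη.2)
  ext i j
  fin_cases i <;> fin_cases j <;> simp [ampDampKraus, Matrix.mul_apply, hs, hs']

theorem krausMap_ampDampKraus (hη : η ∈ Icc (0 : ℝ) 1) (ρ : Matrix (Fin 2) (Fin 2) ℂ) :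
    krausMap (ampDampKraus η) ρ =
      !![η * ρ 0 0, (√η : ℝ) * ρ 0 1; (√η : ℝ) * ρ 1 0, ρ 1 1 + (1 - η) * ρ 0 0] := by
  have hs := ofReal_sqrt_mul_mul_ofReal_sqrt hη.1
  have hs' := ofReal_sqrt_mul_mul_ofReal_sqrt (sub_nonneg.2 hη.2)
  ext i j
  fin_cases i <;> fin_cases j <;>
    simp [krausMap, ampDampKraus, Matrix.mul_apply, Fin.sum_univ_two, mul_comm _ (ρ _ _),
      mul_assoc, hs, hs']

theorem complementaryMap_ampDampKraus (hη : η ∈ Icc (0 : ℝ) 1) (ρ : Matrix (Fin 2) (Fin 2) ℂ) :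
    complementaryMap (ampDampKraus η) ρ =
      !![η * ρ 0 0 + ρ 1 1, (√(1 - η) : ℝ) * ρ 1 0; (√(1 - η) : ℝ) * ρ 0 1, (1 - η) * ρ 0 0] := by
  have hs := ofReal_sqrt_mul_mul_ofReal_sqrt hη.1
  have hs' := ofReal_sqrt_mul_mul_ofReal_sqrt (sub_nonneg.2 hη.2)
  ext i j
  fin_cases i <;> fin_cases j <;>
    simp [complementaryMap, ampDampKraus, Matrix.trace, Matrix.mul_apply, Fin.sum_univ_two,
      mul_comm _ (ρ _ _), mul_assoc, hs, hs']

/-- The population of `|0⟩` and the determinant of a qubit state. -/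
def statePoint (ρ : Matrix (Fin 2) (Fin 2) ℂ) : ℝ × ℝ := ((ρ 0 0).re, ρ.det.re)

theorem det_krausMap_ampDampKraus_re (hη : η ∈ Icc (0 : ℝ) 1) (hρ : ρ.IsHermitian) :
    (krausMap (ampDampKraus η) ρ).det.re = outDet η (statePoint ρ) := by
  have hs := ofReal_sqrt_mul_self hη.1
  have h : (krausMap (ampDampKraus η) ρ).det = outDet η (statePoint ρ) := by
    simp only [outDet, statePoint]
    push_cast
    rw [ofReal_det_re hρ, show ((ρ 0 0).re : ℂ) = ρ 0 0 from hρ.coe_re_apply_self 0,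
      krausMap_ampDampKraus hη,
      Matrix.det_fin_two_of, Matrix.det_fin_two]
    linear_combination (-ρ 0 1 * ρ 1 0) * hs
  rw [h, Complex.ofReal_re]

theorem det_complementaryMap_ampDampKraus_re (hη : η ∈ Icc (0 : ℝ) 1) (hρ : ρ.IsHermitian) :
    (complementaryMap (ampDampKraus η) ρ).det.re = outDet (1 - η) (statePoint ρ) := by
  have hs := ofReal_sqrt_mul_self (sub_nonneg.2 hη.2)
  have h : (complementaryMap (ampDampKraus η) ρ).det = outDet (1 - η) (statePoint ρ) := by
    simp only [outDet, statePoint]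
    push_cast at hs ⊢
    rw [ofReal_det_re hρ, show ((ρ 0 0).re : ℂ) = ρ 0 0 from hρ.coe_re_apply_self 0,
      complementaryMap_ampDampKraus hη,
      Matrix.det_fin_two_of, Matrix.det_fin_two]
    linear_combination (-ρ 0 1 * ρ 1 0) * hs
  rw [h, Complex.ofReal_re]

open scoped ComplexOrder in
theorem statePoint_mem_stateRegion (hρ : ρ.PosSemidef) (htr : ρ.trace = 1) :
    statePoint ρ ∈ stateRegion := by
  have h0 : 0 ≤ (ρ 0 0).re := (Complex.le_def.1 (hρ.diag_nonneg (i := 0))).1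
  have h1 : 0 ≤ (ρ 1 1).re := (Complex.le_def.1 (hρ.diag_nonneg (i := 1))).1
  have htr' : (ρ 0 0).re + (ρ 1 1).re = 1 := by
    simpa [Matrix.trace_fin_two] using congrArg Complex.re htr
  have hdet := det_re_eq hρ.isHermitian
  refine ⟨h0, ?_, (Complex.le_def.1 hρ.det_nonneg).1, ?_⟩
  · simp only [statePoint]
    linarith
  · simp only [statePoint]
    rw [hdet, ← htr', add_sub_cancel_left]
    exact sub_le_self _ (Complex.normSq_nonneg _)

theorem vnEntropy_smul_eq_outEntropy (hρ : ρ.IsHermitian) (htr : ρ.trace = 1) (p : ℝ) :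
    vnEntropy ((p : ℂ) • ρ) = (negMulLog p + p * outEntropy 1 (statePoint ρ)) / log 2 := by
  rw [vnEntropy_smul_of_trace_eq_one hρ htr, outEntropy_one, statePoint]

theorem vnEntropy_smul_krausMap_ampDampKraus (hη : η ∈ Icc (0 : ℝ) 1) (hρ : ρ.IsHermitian)
    (htr : ρ.trace = 1) (p : ℝ) : vnEntropy ((p : ℂ) • krausMap (ampDampKraus η) ρ) =
      (negMulLog p + p * outEntropy η (statePoint ρ)) / log 2 := by
  rw [vnEntropy_smul_of_trace_eq_one (isHermitian_krausMap _ hρ)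
    ((trace_krausMap (sum_conjTranspose_mul_ampDampKraus hη) ρ).trans htr),
    det_krausMap_ampDampKraus_re hη hρ, outEntropy]

theorem vnEntropy_smul_complementaryMap_ampDampKraus (hη : η ∈ Icc (0 : ℝ) 1)
    (hρ : ρ.IsHermitian) (htr : ρ.trace = 1) (p : ℝ) :
    vnEntropy ((p : ℂ) • complementaryMap (ampDampKraus η) ρ) =
      (negMulLog p + p * outEntropy (1 - η) (statePoint ρ)) / log 2 := by
  rw [vnEntropy_smul_of_trace_eq_one (isHermitian_complementaryMap _ hρ)
    ((trace_complementaryMap _ ρ).trans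
      ((trace_krausMap (sum_conjTranspose_mul_ampDampKraus hη) ρ).trans htr)),
    det_complementaryMap_ampDampKraus_re hη hρ, outEntropy]

end AmplitudeDamping

section Mean

variable {X : Type*} [Fintype X] {p : X → ℝ}

open scoped ComplexOrder in
theorem posSemidef_sum_smul {n : Type*} {ρ : X → Matrix n n ℂ} (hp : ∀ x, 0 ≤ p x)
    (hρ : ∀ x, (ρ x).PosSemidef) : (∑ x, (p x : ℂ) • ρ x).PosSemidef :=
  Matrix.posSemidef_sum _ fun x _ => (hρ x).smul (Complex.zero_le_real.2 (hp x))

theorem isHermitian_sum_smul {n : Type*} (p : X → ℝ) {ρ : X → Matrix n n ℂ}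
    (hρ : ∀ x, (ρ x).IsHermitian) : (∑ x, (p x : ℂ) • ρ x).IsHermitian := by
  rw [Matrix.IsHermitian, Matrix.conjTranspose_sum]
  exact Finset.sum_congr rfl fun x _ => isHermitian_ofReal_smul (hρ x) (p x)

theorem trace_sum_smul {n : Type*} [Fintype n] {ρ : X → Matrix n n ℂ} (hp1 : ∑ x, p x = 1)
    (hρ : ∀ x, (ρ x).trace = 1) : (∑ x, (p x : ℂ) • ρ x).trace = 1 := by
  simp only [Matrix.trace_sum, Matrix.trace_smul, hρ, smul_eq_mul, mul_one]
  exact_mod_cast hp1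

end Mean

section Rates

variable {η : ℝ} {X : Type*} [Fintype X]

/-- The rate polyhedron of an ensemble with probabilities `p` and reduced states `x`, given by
population and determinant, at the input of the amplitude damping channel of transmissivity `η`,
when the channel output has entropy `s` in nats. -/
def dampedPolyhedron (η : ℝ) (p : X → ℝ) (x : X → ℝ × ℝ) (s : ℝ) : Set (ℝ × ℝ × ℝ) :=
  ratePolyhedron
    ((s + ∑ i, p i * (outEntropy 1 (x i) - outEntropy (1 - η) (x i))) / log 2)
    ((∑ i, p i * (outEntropy η (x i) - outEntropy (1 - η) (x i))) / log 2)
    ((s - ∑ i, p i * outEntropy (1 - η) (x i)) / log 2)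

theorem dampedPolyhedron_subset_of_dominates {p : X → ℝ} {x : X → ℝ × ℝ} {s t Y : ℝ}
    (h : Dominates η p x Y) (hst : s ≤ t) : dampedPolyhedron η p x s ⊆
      dampedPolyhedron η ![(1 : ℝ), 0] (fun _ => (∑ i, p i * (x i).1, Y)) t := by
  rintro r ⟨hmutual, hcoherent, hholevo⟩
  have : 0 < log 2 := log_pos one_lt_two
  have h1 := h.mutual_le
  have h2 := h.coherent_le
  have h3 := h.environment_le
  simp only [dampedPolyhedron, Fin.sum_univ_two, Matrix.cons_val_zero, Matrix.cons_val_one,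
    one_mul, zero_mul, add_zero]
  refine ⟨hmutual.trans ?_, hcoherent.trans ?_, hholevo.trans ?_⟩ <;> gcongr

theorem h2_eq_binEntropy_div_log (y : ℝ) : h2 y = binEntropy y / log 2 := by
  simp only [h2, logb, binEntropy_eq_negMulLog_add_negMulLog_one_sub, negMulLog]
  ring

theorem g_eq_outEntropy_div_log (q z ν : ℝ) :
    g q z ν = outEntropy z (q, q * (1 - q) * (1 - ν ^ 2)) / log 2 := by
  rw [g, h2_eq_binEntropy_div_log, outEntropy, detEntropy, outDet]
  ring_nf

theorem ratePolyhedron_h2_g (η : ℝ) (p q ν : X → ℝ) :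
    ratePolyhedron (h2 (η * ∑ x, p x * q x) + ∑ x, p x * (g (q x) 1 (ν x) - g (q x) (1 - η) (ν x)))
        (∑ x, p x * (g (q x) η (ν x) - g (q x) (1 - η) (ν x)))
        (h2 (η * ∑ x, p x * q x) - ∑ x, p x * g (q x) (1 - η) (ν x)) =
      dampedPolyhedron η p (fun x => (q x, q x * (1 - q x) * (1 - ν x ^ 2)))
        (binEntropy (η * ∑ x, p x * q x)) := by
  simp only [dampedPolyhedron, h2_eq_binEntropy_div_log, g_eq_outEntropy_div_log, ← sub_div,
    ← mul_div_assoc, ← Finset.sum_div, ← add_div]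

variable [DecidableEq X] {A : Type*} [Fintype A] [DecidableEq A] {p : X → ℝ}
  {φ : X → A × Fin 2 → ℂ}

theorem ratePolyhedron_cqState_ampDampKraus (hη : η ∈ Icc (0 : ℝ) 1) (hp1 : ∑ x, p x = 1)
    (hφ : ∀ x, ∑ i, ‖φ x i‖ ^ 2 = 1) :
    ratePolyhedron (mutualInfo (cqState (ampDampKraus η) p φ))
        (coherentInfo (cqState (ampDampKraus η) p φ))
        (holevoInfo (cqState (ampDampKraus η) p φ) + coherentInfo (cqState (ampDampKraus η) p φ)) =
      dampedPolyhedron η p (fun x => statePoint (reducedState (φ x)))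
        (outEntropy η (statePoint (∑ x, (p x : ℂ) • reducedState (φ x)))) := by
  have hK := sum_conjTranspose_mul_ampDampKraus hη
  have hρ := fun x => isHermitian_reducedState (φ x)
  have htr := fun x => trace_reducedState (hφ x)
  have hmean := isHermitian_sum_smul p hρ
  have hB := vnEntropy_smul_krausMap_ampDampKraus hη hmean (trace_sum_smul hp1 htr) 1
  rw [Complex.ofReal_one, one_smul, negMulLog_one, zero_add, one_mul, ← margB_cqState] at hB
  have hXA := vnEntropy_margXA_cqState (p := p) (φ := φ) hK
  have hXB := vnEntropy_margXB_cqState (K := ampDampKraus η) (p := p) (φ := φ)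
  have hXAB := vnEntropy_cqState (K := ampDampKraus η) (p := p) (φ := φ)
  simp only [vnEntropy_smul_eq_outEntropy (hρ _) (htr _),
    vnEntropy_smul_krausMap_ampDampKraus hη (hρ _) (htr _),
    vnEntropy_smul_complementaryMap_ampDampKraus hη (hρ _) (htr _), ← Finset.sum_div,
    Finset.sum_add_distrib] at hXA hXB hXAB
  rw [mutualInfo, coherentInfo, holevoInfo, hB, hXA, hXB, hXAB, margX_cqState hK hφ,
    vnEntropy_diagonal, dampedPolyhedron]
  simp only [mul_sub, Finset.sum_sub_distrib]
  congr 1 <;> ring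

end Rates

section Converse

variable {η : ℝ}

theorem exists_coherence_parameter {x : ℝ × ℝ} (hx : x ∈ stateRegion) :
    ∃ ν ∈ Icc (0 : ℝ) 1, x = (x.1, x.1 * (1 - x.1) * (1 - ν ^ 2)) := by
  obtain ⟨h0, h1, h2, h3⟩ := hx
  rcases (mul_nonneg h0 (sub_nonneg.2 h1)).eq_or_lt with hm | hm
  · exact ⟨0, by simp, Prod.ext rfl (by linarith)⟩
  · refine ⟨√(1 - x.2 / (x.1 * (1 - x.1))), ⟨sqrt_nonneg _, sqrt_le_one.2 ?_⟩, Prod.ext rfl ?_⟩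
    · exact sub_le_self _ (div_nonneg h2 hm.le)
    · rw [sq_sqrt (sub_nonneg.2 ((div_le_one hm).2 h3)), sub_sub_cancel, mul_div_cancel₀ _ hm.ne']

open scoped ComplexOrder in
theorem exists_mem_dampedPolyhedron_of_mem_tripleRegion (hη : η ∈ Icc (0 : ℝ) 1)
    {r : ℝ × ℝ × ℝ} (hr : r ∈ tripleRegion (ampDampKraus η)) :
    ∃ q ∈ Icc (0 : ℝ) 1, ∃ ν ∈ Icc (0 : ℝ) 1, r ∈ dampedPolyhedron η ![(1 : ℝ), 0]
      (fun _ => (q, q * (1 - q) * (1 - ν ^ 2))) (binEntropy (η * q)) := by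
  obtain ⟨n, d, p, φ, hp, hp1, hφ, hr⟩ := hr
  rw [ratePolyhedron_cqState_ampDampKraus hη hp1 hφ] at hr
  have hpsd := fun x => Matrix.posSemidef_self_mul_conjTranspose (stateMatrix (φ x))
  have htr := fun x => trace_reducedState (hφ x)
  have hmean := statePoint_mem_stateRegion (posSemidef_sum_smul hp hpsd) (trace_sum_smul hp1 htr)
  have hfst : (statePoint (∑ x, (p x : ℂ) • reducedState (φ x))).1 =
      ∑ x, p x * (statePoint (reducedState (φ x))).1 := by
    simp [statePoint, Matrix.sum_apply]
  obtain ⟨Y, hY⟩ := exists_dominates hη hp hp1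
    fun x => statePoint_mem_stateRegion (hpsd x) (htr x)
  obtain ⟨ν, hν, hYν⟩ := exists_coherence_parameter hY.mem
  refine ⟨_, ⟨hY.mem.1, hY.mem.2.1⟩, ν, hν, ?_⟩
  rw [← hYν]
  exact dampedPolyhedron_subset_of_dominates hY (hfst ▸ outEntropy_le_binEntropy hη hmean) hr

end Converse

section Achievability

variable {η q ν : ℝ}

/-- The two-qubit pure state whose reduced state on the second qubit has population `q` and
coherence `ν √(q (1 - q))`. -/
def trialState (q ν : ℝ) (i : Fin 2 × Fin 2) : ℂ :=
  ((!![√q, ν * √(1 - q); 0, √(1 - ν ^ 2) * √(1 - q)] i.1 i.2 : ℝ) : ℂ)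

theorem sum_norm_sq_trialState (hq : q ∈ Icc (0 : ℝ) 1) (hν : ν ^ 2 ≤ 1) :
    ∑ i, ‖trialState q ν i‖ ^ 2 = 1 := by
  simp only [trialState, Complex.norm_real, norm_eq_abs, sq_abs, Fintype.sum_prod_type,
    Fin.sum_univ_two, Matrix.of_apply, Matrix.cons_val_zero, Matrix.cons_val_one, mul_pow,
    sq_sqrt hq.1, sq_sqrt (sub_nonneg.2 hq.2), sq_sqrt (sub_nonneg.2 hν)]
  ring

theorem reducedState_trialState (hq : q ∈ Icc (0 : ℝ) 1) (hν : ν ^ 2 ≤ 1) :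
    reducedState (trialState q ν) =
      (!![q, ν * (√q * √(1 - q)); ν * (√q * √(1 - q)), 1 - q]).map Complex.ofReal := by
  have h0 := mul_self_sqrt hq.1
  have h1 := mul_self_sqrt (sub_nonneg.2 hq.2)
  have h2 := mul_self_sqrt (sub_nonneg.2 hν)
  ext i j
  simp only [reducedState, stateMatrix, Matrix.mul_apply, Matrix.conjTranspose_apply,
    Matrix.of_apply, trialState, Matrix.map_apply, Fin.sum_univ_two, RCLike.star_def,
    Complex.conj_ofReal, ← Complex.ofReal_mul, ← Complex.ofReal_add]
  congr 1
  fin_cases i <;> fin_cases j <;> simp only [Fin.isValue, Fin.zero_eta, Fin.mk_one,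
    Matrix.cons_val', Matrix.cons_val_zero, Matrix.cons_val_one, Matrix.cons_val_fin_one]
  · linear_combination h0
  · ring
  · ring
  · linear_combination (ν ^ 2 + √(1 - ν ^ 2) * √(1 - ν ^ 2)) * h1 + (1 - q) * h2

theorem statePoint_map_ofReal (M : Matrix (Fin 2) (Fin 2) ℝ) :
    statePoint (M.map Complex.ofReal) = (M 0 0, M.det) :=
  Prod.ext rfl (congrArg Complex.re (Complex.ofRealHom.map_det M).symm)

theorem statePoint_reducedState_trialState (hq : q ∈ Icc (0 : ℝ) 1) (hν : ν ^ 2 ≤ 1) :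
    statePoint (reducedState (trialState q ν)) = (q, q * (1 - q) * (1 - ν ^ 2)) := by
  rw [reducedState_trialState hq hν]
  have hsqrt : (√q * √(1 - q)) ^ 2 = q * (1 - q) := by
    rw [mul_pow, sq_sqrt hq.1, sq_sqrt (sub_nonneg.2 hq.2)]
  rw [statePoint_map_ofReal, Matrix.det_fin_two_of]
  refine Prod.ext rfl ?_
  linear_combination -ν ^ 2 * hsqrt

theorem dampedPolyhedron_comp_equiv {X X' : Type*} [Fintype X] [Fintype X'] (e : X' ≃ X) (η : ℝ)
    (p : X → ℝ) (x : X → ℝ × ℝ) (s : ℝ) :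
    dampedPolyhedron η (p ∘ e) (x ∘ e) s = dampedPolyhedron η p x s := by
  have h : ∀ f : ℝ × ℝ → ℝ, ∑ i, (p ∘ e) i * f ((x ∘ e) i) = ∑ i, p i * f (x i) := fun f =>
    e.sum_comp fun i => p i * f (x i)
  simp only [dampedPolyhedron, mul_sub, Finset.sum_sub_distrib, h]

theorem mem_tripleRegion_of_mem_dampedPolyhedron {X : Type*} [Fintype X] {d : ℕ} {p : X → ℝ}
    {φ : X → Fin d × Fin 2 → ℂ} {r : ℝ × ℝ × ℝ} (hη : η ∈ Icc (0 : ℝ) 1) (hp : ∀ x, 0 ≤ p x)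
    (hp1 : ∑ x, p x = 1) (hφ : ∀ x, ∑ i, ‖φ x i‖ ^ 2 = 1)
    (hr : r ∈ dampedPolyhedron η p (fun x => statePoint (reducedState (φ x)))
      (outEntropy η (statePoint (∑ x, (p x : ℂ) • reducedState (φ x))))) :
    r ∈ tripleRegion (ampDampKraus η) := by
  let e := (Fintype.equivFin X).symm
  have hpe : ∑ x, (p ∘ e) x = 1 := (e.sum_comp p).trans hp1
  refine ⟨_, d, p ∘ e, φ ∘ e, fun x => hp _, hpe, fun x => hφ _, ?_⟩
  rw [ratePolyhedron_cqState_ampDampKraus (φ := φ ∘ e) hη hpe fun x => hφ _]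
  rw [← dampedPolyhedron_comp_equiv e, ← e.sum_comp] at hr
  exact hr

variable {X : Type*} [Fintype X] {p q ν : X → ℝ}

theorem sum_signed_mul (p f : X → ℝ) :
    ∑ i : X × Fin 2, p i.1 / 2 * f i.1 = ∑ x, p x * f x := by
  simp only [Fintype.sum_prod_type, Fin.sum_univ_two, ← add_mul, add_halves]

theorem dampedPolyhedron_signed (η : ℝ) (p : X → ℝ) (x : X → ℝ × ℝ) (s : ℝ) :
    dampedPolyhedron η (fun i : X × Fin 2 => p i.1 / 2) (fun i => x i.1) s =
      dampedPolyhedron η p x s := by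
  have h := fun f : ℝ × ℝ → ℝ => sum_signed_mul p fun i => f (x i)
  simp only [dampedPolyhedron, mul_sub, Finset.sum_sub_distrib, h]

theorem sum_signed_smul_reducedState_trialState (hp1 : ∑ x, p x = 1)
    (hq : ∀ x, q x ∈ Icc (0 : ℝ) 1) (hν : ∀ x, ν x ^ 2 ≤ 1) :
    ∑ i : X × Fin 2, ((p i.1 / 2 : ℝ) : ℂ) •
        reducedState (trialState (q i.1) ((-1) ^ (i.2 : ℕ) * ν i.1)) =
      (!![∑ x, p x * q x, 0; 0, 1 - ∑ x, p x * q x]).map Complex.ofReal := by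
  have hcoherence : ∀ x, ((p x / 2 : ℝ) : ℂ) • reducedState (trialState (q x) (ν x)) +
      ((p x / 2 : ℝ) : ℂ) • reducedState (trialState (q x) (-ν x)) =
        (!![p x * q x, 0; 0, p x - p x * q x]).map Complex.ofReal := fun x => by
    rw [reducedState_trialState (hq x) (hν x),
      reducedState_trialState (hq x) ((neg_sq (ν x)).trans_le (hν x))]
    ext i j
    fin_cases i <;> fin_cases j <;> simp <;> ring
  simp only [Fintype.sum_prod_type, Fin.sum_univ_two, Fin.val_zero, Fin.val_one, pow_zero, pow_one,
    one_mul, neg_one_mul, hcoherence]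
  rw [← hp1, ← Finset.sum_sub_distrib]
  ext i j
  fin_cases i <;> fin_cases j <;> simp [Matrix.sum_apply]

theorem mem_tripleRegion_of_mem_dampedPolyhedron_binEntropy {r : ℝ × ℝ × ℝ}
    (hη : η ∈ Icc (0 : ℝ) 1) (hp : ∀ x, 0 ≤ p x) (hp1 : ∑ x, p x = 1)
    (hq : ∀ x, q x ∈ Icc (0 : ℝ) 1) (hν : ∀ x, ν x ^ 2 ≤ 1)
    (hr : r ∈ dampedPolyhedron η p (fun x => (q x, q x * (1 - q x) * (1 - ν x ^ 2)))
      (binEntropy (η * ∑ x, p x * q x))) :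
    r ∈ tripleRegion (ampDampKraus η) := by
  have hsq : ∀ i : X × Fin 2, ((-1) ^ (i.2 : ℕ) * ν i.1) ^ 2 = ν i.1 ^ 2 := fun i => by
    rw [mul_pow, ← pow_mul, mul_comm _ 2, pow_mul, neg_one_sq, one_pow, one_mul]
  have hν' := fun i => (hsq i).trans_le (hν i.1)
  refine mem_tripleRegion_of_mem_dampedPolyhedron (p := fun i : X × Fin 2 => p i.1 / 2)
    (φ := fun i => trialState (q i.1) ((-1) ^ (i.2 : ℕ) * ν i.1)) hη
    (fun i => div_nonneg (hp _) zero_le_two) ?_ (fun i => sum_norm_sq_trialState (hq i.1) (hν' i))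
    ?_
  · simpa [hp1] using sum_signed_mul p 1
  · rw [sum_signed_smul_reducedState_trialState hp1 hq hν, statePoint_map_ofReal,
      Matrix.det_fin_two_of, mul_zero, sub_zero, Matrix.of_apply, Matrix.cons_val_zero,
      Matrix.cons_val_zero, outEntropy_mul_one_sub]
    simp only [statePoint_reducedState_trialState (hq _) (hν' _), hsq]
    rwa [dampedPolyhedron_signed η p fun x => (q x, q x * (1 - q x) * (1 - ν x ^ 2))]

end Achievability

end TripleTradeoff

end

theorem mainTheorem4 (η : ℝ) (hη : η ∈ Set.Icc (0 : ℝ) 1) :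
    TripleTradeoff.tripleRegion (TripleTradeoff.ampDampKraus η) =
      {r : ℝ × ℝ × ℝ | ∃ p q ν : Fin 2 → ℝ,
        p 0 ∈ Set.Icc (0 : ℝ) 1 ∧ p 1 = 1 - p 0 ∧
        (∀ x, q x ∈ Set.Icc (0 : ℝ) 1) ∧ (∀ x, ν x ∈ Set.Icc (0 : ℝ) 1) ∧
        r ∈ TripleTradeoff.ratePolyhedron
          (TripleTradeoff.h2 (η * ∑ x, p x * q x) +
            ∑ x, p x * (TripleTradeoff.g (q x) 1 (ν x) - TripleTradeoff.g (q x) (1 - η) (ν x)))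
          (∑ x, p x * (TripleTradeoff.g (q x) η (ν x) - TripleTradeoff.g (q x) (1 - η) (ν x)))
          (TripleTradeoff.h2 (η * ∑ x, p x * q x) -
            ∑ x, p x * TripleTradeoff.g (q x) (1 - η) (ν x))} := by
  simp only [TripleTradeoff.ratePolyhedron_h2_g]
  refine Set.Subset.antisymm (fun r hr => ?_) ?_
  · obtain ⟨q, hq, ν, hν, hr⟩ :=
      TripleTradeoff.exists_mem_dampedPolyhedron_of_mem_tripleRegion hη hr
    exact ⟨![1, 0], fun _ => q, fun _ => ν, by simp, by simp, fun _ => hq, fun _ => hν,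
      by simpa using hr⟩
  · rintro r ⟨p, q, ν, hp0, hp1, hq, hν, hr⟩
    refine TripleTradeoff.mem_tripleRegion_of_mem_dampedPolyhedron_binEntropy hη
      (Fin.forall_fin_two.2 ⟨hp0.1, hp1 ▸ sub_nonneg.2 hp0.2⟩) ?_ hq
      (fun x => pow_le_one₀ (hν x).1 (hν x).2) hr
    rw [Fin.sum_univ_two, hp1, add_sub_cancel]
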